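/- Let $G$ be a step $2$ Carnot group with stratified Lie algebra $\mathfrak g=\mathfrak g_1\oplus\mathfrak g_2$, $[\mathfrak g_1,\mathfrak g_1]=\mathfrak g_2\neq\{0\}$, $[\mathfrak g,\mathfrak g_2]=0$, endowed with a scalar product $g$ such that $\mathfrak g_1\perp\mathfrak g_2$. Let $k=\dim\mathfrak g_1$, $n=\dim\mathfrak g$. Identify $G$ with $\mathfrak g_1\oplus\mathfrak g_2\simeq\mathbb R^k\times\mathbb R^{n-k}\ni(x,z)$ through the group exponential map and orthonormal bases $(e_i)$, $(f_\alpha)$, so that $p\star q=p+q+\tfrac12[p,q]$, the identity is $e=(0,0)$, and the left-invariant fields $X_1,\dots,X_k$ generated by $e_1,\dots,e_k$ are a global orthonormal frame of a sub-Riemannian structure on $G$. For $V\in\mathfrak g_2$ let $J_V:\mathfrak g_1\to\mathfrak g_1$ be defined by $g(X,J_VY)=g(V,[X,Y])$. Assume that $G$ is of generalized H-type: there is a symmetric, non-negative, non-zero operator $S:\mathfrak g_1\to\mathfrak g_1$ with $J_VJ_W+J_WJ_V=-2g(V,W)S^2$ for all $V,W\in\mathfrak g_2$. A horizontal curve is a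 Lipschitz curve $\gamma:[0,1]\to G$ with $\dot\gamma(t)=\sum_i u_i(t)X_i(\gamma(t))$ for a.e. $t$, where $u\in L^\infty([0,1],\mathbb R^k)$ is its control. Its energy on $[a,b]\subseteq[0,1]$ is $\frac12\int_a^b|u(t)|^2dt$, and $\gamma$ is a geodesic if every $t\in[0,1]$ has a neighbourhood in $[0,1]$ such that on each closed subinterval $[a,b]$ of it, $\gamma|_{[a,b]}$ minimizes the energy among the horizontal curves $[a,b]\to G$ with the same endpoints. The curve $\gamma$ is abnormal if there is a covector $\lambda_1\neq0$ at $\gamma(1)$ with $\lambda_1\circ D_uE_{\gamma(0)}=0$, where $E_p:L^\infty([0,1],\mathbb R^k)\to G$ sends a control to the final point of the horizontal curve with that control starting at $p$. Let $H(\lambda)=\frac12\sum_i\langle\lambda,X_i\rangle^2$ on $T^*G$. A geodesic with $\gamma(0)=e$ is normal with initial covector $\lambda\in T_e^*G$ if it is the projection of a solution on $[0,1]$ of the Hamilton equations of $H$ starting at $\lambda$; $\exp_e(\lambda)$ is the final point (at time $1$) of the projection of that solution. Write $\lambda=(u,v)$ for $\lambda=\sum_iu_idx_i+\sum_\alpha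 v_\alpha dz_\alpha\in T_e^*G$. Then: 1. A curve $\gamma:[0,1]\to G$ is an abnormal curve if and only if it is Lipschitz and horizontal with a control $u\in L^\infty([0,1],\mathbb R^k)$ such that $u(t)\in\ker S$ for a.e. $t$. 2. A curve $\gamma:[0,1]\to G$ is an abnormal geodesic if and only if there is $u\in\ker S$ with $\gamma(t)=\gamma(0)\star(tu,0)$ for all $t\in[0,1]$. In particular, for $\gamma(0)=e$: $\gamma$ is an abnormal geodesic if and only if $\gamma(t)=(tu,0)$ on $[0,1]$ for some $u\in\ker S$, and if and only if it is a normal geodesic with initial covector $(u,v)$ for some $u\in\ker S$ and some $v\in\mathbb R^{n-k}$. 3. For every $u\in\ker S$ and every $v\in\mathbb R^{n-k}$, the curve $t\mapsto(tu,0)$, $t\in[0,1]$, is a normal geodesic with initial covector $(u,v)$, and $\exp_e(tu,tv)=(tu,0)$ for all $t\in[0,1]$. -/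

import Mathlib

open MeasureTheory Set
open scoped RealInnerProductSpace ENNReal NNReal

set_option linter.unusedSectionVars false

noncomputable section

/-- A step `2` Carnot group in exponential coordinates of the first kind.
The first layer `V` and the second layer `W` of the stratified Lie algebra `V ⊕ W` are Euclidean
spaces (orthogonal to each other), the Lie bracket is determined by the alternating bilinear map
`bracket : V × V → W`, and `[V, V] = W`, with `W ≠ 0` in order that the step is exactly `2`.
The underlying manifold of the group is `V × W`, the exponential map being the identity. -/
structure StepTwoCarnot (V W : Type*) [NormedAddCommGroup V] [InnerProductSpace ℝ V]
    [FiniteDimensional ℝ V] [NormedAddCommGroup W] [InnerProductSpace ℝ W]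
    [FiniteDimensional ℝ W] where
  bracket : V →ₗ[ℝ] V →ₗ[ℝ] W
  bracket_self : ∀ x, bracket x x = 0
  span_bracket : Submodule.span ℝ {w : W | ∃ x y, bracket x y = w} = ⊤
  nontrivial_snd : Nontrivial W

/-- Controls: elements `u ∈ L^∞([0,1], V)`. -/
abbrev CarnotControl (V : Type*) [NormedAddCommGroup V] : Type _ :=
  Lp V ∞ (volume.restrict (Icc (0 : ℝ) 1))

namespace StepTwoCarnot

variable {V W : Type*} [NormedAddCommGroup V] [InnerProductSpace ℝ V] [FiniteDimensional ℝ V]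
  [NormedAddCommGroup W] [InnerProductSpace ℝ W] [FiniteDimensional ℝ W]

/-! ### Group law, the operators `J`, generalized H-type condition -/

/-- The group law, given by the Baker-Campbell-Hausdorff formula
`p ⋆ q = p + q + [p, q] / 2`. The identity is `0` and the inverse of `p` is `-p`. -/
def mul (G : StepTwoCarnot V W) (p q : V × W) : V × W :=
  (p.1 + q.1, p.2 + q.2 + (2⁻¹ : ℝ) • G.bracket p.1 q.1)

theorem bracket_swap (G : StepTwoCarnot V W) (x y : V) : G.bracket y x = -G.bracket x y := by
  have h := G.bracket_self (x + y)
  simp only [map_add, LinearMap.add_apply, G.bracket_self, zero_add, add_zero] at h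
  exact eq_neg_of_add_eq_zero_left h

theorem mul_assoc (G : StepTwoCarnot V W) (p q r : V × W) :
    G.mul (G.mul p q) r = G.mul p (G.mul q r) := by
  simp only [mul, map_add, LinearMap.add_apply, smul_add]
  exact Prod.ext (by simp only; abel) (by simp only; abel)

theorem zero_mul (G : StepTwoCarnot V W) (p : V × W) : G.mul 0 p = p := by
  simp [mul]

theorem mul_zero (G : StepTwoCarnot V W) (p : V × W) : G.mul p 0 = p := by
  simp [mul]

theorem neg_mul (G : StepTwoCarnot V W) (p : V × W) : G.mul (-p) p = 0 := by
  simp [mul, G.bracket_self]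

/-- The operator `J_v : V → V`, for `v ∈ W`, characterized by `⟪x, J_v y⟫ = ⟪v, [x, y]⟫`
(see `inner_J`). -/
def J (G : StepTwoCarnot V W) (v : W) : V →ₗ[ℝ] V where
  toFun y := LinearMap.adjoint (G.bracket.flip y) v
  map_add' y z := by simp [map_add]
  map_smul' c y := by simp [map_smul]

theorem inner_J (G : StepTwoCarnot V W) (v : W) (x y : V) :
    ⟪x, G.J v y⟫ = ⟪v, G.bracket x y⟫ := by
  change ⟪x, LinearMap.adjoint (G.bracket.flip y) v⟫ = _
  rw [LinearMap.adjoint_inner_right, real_inner_comm]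
  rfl

/-- `S` is an operator exhibiting `G` as a group of generalized H-type: `S` is symmetric,
non-negative and non-zero, and `J_v J_w + J_w J_v = -2 ⟪v, w⟫ S²` for all `v, w`. -/
structure IsGenHType (G : StepTwoCarnot V W) (S : V →ₗ[ℝ] V) : Prop where
  isPositive : S.IsPositive
  ne_zero : S ≠ 0
  clifford : ∀ v w : W,
    G.J v ∘ₗ G.J w + G.J w ∘ₗ G.J v = (-2 * ⟪v, w⟫) • (S ∘ₗ S)

/-! ### Sub-Riemannian structure, horizontal curves, geodesics -/

/-- The left-invariant vector field with value `(w, 0)` at the identity, `w ∈ V`. For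
`w` in an orthonormal basis of `V`, these fields form a global orthonormal frame of the
distribution. -/
def field (G : StepTwoCarnot V W) (w : V) (p : V × W) : V × W :=
  (w, (2⁻¹ : ℝ) • G.bracket p.1 w)

theorem hasDerivAt_mul_field (G : StepTwoCarnot V W) (w : V) (p : V × W) :
    HasDerivAt (fun s : ℝ => G.mul p (s • w, 0)) (G.field w p) 0 := by
  have h1 : HasDerivAt (fun s : ℝ => p.1 + s • w) w 0 := by
    simpa using ((hasDerivAt_id (0 : ℝ)).smul_const w).const_add p.1
  have h2 : HasDerivAt (fun s : ℝ => p.2 + 0 + (2⁻¹ : ℝ) • G.bracket p.1 (s • w))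
      ((2⁻¹ : ℝ) • G.bracket p.1 w) 0 := by
    have := (((hasDerivAt_id (0 : ℝ)).smul_const (G.bracket p.1 w)).const_smul
      (2⁻¹ : ℝ)).const_add (p.2 + 0)
    simpa using this
  exact h1.prodMk h2

/-- The curve `γ`, on the interval `[a, b]`, has control `u`: `γ' = ∑ uᵢ Xᵢ(γ)` a.e. -/
def HasControlOn (G : StepTwoCarnot V W) (γ : ℝ → V × W) (u : ℝ → V) (a b : ℝ) : Prop :=
  ∀ᵐ t ∂volume.restrict (Icc a b), HasDerivAt γ (G.field (u t) (γ t)) t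

/-- Horizontal curves on `[a, b]`: Lipschitz curves which are a.e. tangent to the
distribution. Only the restriction of `γ` to `[a, b]` matters. -/
def IsHorizontalOn (G : StepTwoCarnot V W) (γ : ℝ → V × W) (a b : ℝ) : Prop :=
  (∃ K : ℝ≥0, LipschitzOnWith K γ (Icc a b)) ∧
    ∀ᵐ t ∂volume.restrict (Icc a b), ∃ w : V, HasDerivAt γ (G.field w (γ t)) t

/-- The energy of a horizontal curve on `[a, b]`. The sub-Riemannian norm of
the horizontal vector `G.field w p` is the norm of its first component `w`. -/
def energy (_G : StepTwoCarnot V W) (γ : ℝ → V × W) (a b : ℝ) : ℝ :=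
  2⁻¹ * ∫ t in a..b, ‖(deriv γ t).1‖ ^ 2

/-- Geodesics on `[0, 1]`: horizontal curves which locally minimize the energy
between their endpoints, i.e. every sufficiently short piece of the curve has the least energy among
the horizontal curves, defined on the same interval, with the same endpoints. -/
def IsGeodesic (G : StepTwoCarnot V W) (γ : ℝ → V × W) : Prop :=
  G.IsHorizontalOn γ 0 1 ∧
    ∀ t ∈ Icc (0 : ℝ) 1, ∃ ε > 0, ∀ a b : ℝ, 0 ≤ a → a ≤ b → b ≤ 1 → |a - t| < ε → |b - t| < ε →
      ∀ η : ℝ → V × W, G.IsHorizontalOn η a b → η a = γ a → η b = γ b →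
        G.energy γ a b ≤ G.energy η a b

/-! ### End-point map and abnormal curves -/

/-- The first component of the horizontal curve starting at `p` with control `u`. -/
def trajFst (p : V × W) (u : ℝ → V) (t : ℝ) : V :=
  p.1 + ∫ s in (0 : ℝ)..t, u s

/-- The horizontal curve starting at `p` with control `u`, i.e. the solution of
`γ' = ∑ uᵢ Xᵢ(γ)`, `γ(0) = p` (see `existsUnique_traj`). -/
def traj (G : StepTwoCarnot V W) (p : V × W) (u : ℝ → V) (t : ℝ) : V × W :=
  (trajFst p u t, p.2 + (2⁻¹ : ℝ) • ∫ s in (0 : ℝ)..t, G.bracket (trajFst p u s) (u s))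

/-- The end-point map with base point `p`. -/
def endpoint (G : StepTwoCarnot V W) (p : V × W) (u : CarnotControl V) : V × W :=
  G.traj p u 1

/-- Abnormal curves: horizontal curves `γ : [0, 1] → V × W` whose control `u` admits
a non-zero covector `l` with `l ∘ D_u E = 0`, where `E` is the end-point map with base point
`γ(0)` and `D` is the Fréchet differential on `L^∞([0,1], V)`. -/
def IsAbnormal (G : StepTwoCarnot V W) (γ : ℝ → V × W) : Prop :=
  G.IsHorizontalOn γ 0 1 ∧
    ∃ u : CarnotControl V, G.HasControlOn γ u 0 1 ∧
      ∃ D : CarnotControl V →L[ℝ] V × W, HasFDerivAt (G.endpoint (γ 0)) D u ∧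
        ∃ l : V × W →L[ℝ] ℝ, l ≠ 0 ∧ l ∘L D = 0

/-! ### Hamiltonian, normal geodesics, exponential map -/

/-- The sub-Riemannian Hamiltonian `H(p, ξ) = ½ ∑ᵢ ⟨ξ, Xᵢ(p)⟩²`, the cotangent bundle being
identified with `(V × W) × (V × W)*`. -/
def hamiltonian (G : StepTwoCarnot V W) (p : V × W) (ξ : V × W →L[ℝ] ℝ) : ℝ :=
  2⁻¹ * ∑ i, (ξ (G.field (stdOrthonormalBasis ℝ V i) p)) ^ 2

/-- Normal extremals on `[0, 1]`: solutions `(p(t), ξ(t))` of Hamilton's equations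
`p' = ∂H/∂ξ`, `ξ' = -∂H/∂p`. -/
def IsNormalExtremal (G : StepTwoCarnot V W) (p : ℝ → V × W) (ξ : ℝ → V × W →L[ℝ] ℝ) : Prop :=
  ∀ t ∈ Icc (0 : ℝ) 1,
    (∃ w : V × W, HasDerivWithinAt p w (Icc 0 1) t ∧
      ∀ η : V × W →L[ℝ] ℝ, η w = fderiv ℝ (G.hamiltonian (p t)) (ξ t) η) ∧
    HasDerivWithinAt ξ (-fderiv ℝ (fun q => G.hamiltonian q (ξ t)) (p t)) (Icc 0 1) t

/-- The covector `∑ uᵢ dxᵢ + ∑ v_α dz_α`. -/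
def covector (u : V) (v : W) : V × W →L[ℝ] ℝ :=
  (innerSL ℝ u).coprod (innerSL ℝ v)

/-- `γ` is a normal geodesic, starting at the identity, with initial covector `l`. -/
def IsNormalGeodesic (G : StepTwoCarnot V W) (γ : ℝ → V × W) (l : V × W →L[ℝ] ℝ) : Prop :=
  G.IsGeodesic γ ∧ ∃ (p : ℝ → V × W) (ξ : ℝ → V × W →L[ℝ] ℝ),
    G.IsNormalExtremal p ξ ∧ p 0 = 0 ∧ ξ 0 = l ∧ ∀ t ∈ Icc (0 : ℝ) 1, γ t = p t

open Classical in
/-- The sub-Riemannian exponential map at the identity: the final point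
of the projection of the normal extremal with initial covector `l`. -/
def expMap (G : StepTwoCarnot V W) (l : V × W →L[ℝ] ℝ) : V × W :=
  if h : ∃ (p : ℝ → V × W) (ξ : ℝ → V × W →L[ℝ] ℝ),
      G.IsNormalExtremal p ξ ∧ p 0 = 0 ∧ ξ 0 = l then h.choose 1 else 0

/-! ### `traj` is the unique horizontal curve with a given control -/

theorem ae_norm_control_le (u : CarnotControl V) :
    ∀ᵐ t : ℝ, t ∈ Icc (0 : ℝ) 1 → ‖u t‖ ≤ ‖u‖ := by
  rw [← ae_restrict_iff' measurableSet_Icc]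
  have h := ae_le_eLpNormEssSup (f := u) (μ := volume.restrict (Icc (0 : ℝ) 1))
  filter_upwards [h] with t ht
  rw [← eLpNorm_exponent_top] at ht
  have h2 := ENNReal.toReal_mono (Lp.eLpNorm_ne_top u) ht
  simpa [Lp.norm_def] using h2

theorem intervalIntegrable_control (u : CarnotControl V) :
    IntervalIntegrable u volume 0 1 := by
  rw [intervalIntegrable_iff_integrableOn_Icc_of_le zero_le_one]
  exact (Lp.memLp u).integrable le_top

theorem lipschitzOn_integral {F : Type*} [NormedAddCommGroup F] [NormedSpace ℝ F]
    {f : ℝ → F} {C : ℝ} (hC : 0 ≤ C)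
    (hf : IntervalIntegrable f volume 0 1) (hb : ∀ᵐ t : ℝ, t ∈ Icc (0 : ℝ) 1 → ‖f t‖ ≤ C) :
    LipschitzOnWith ⟨C, hC⟩ (fun t => ∫ s in (0 : ℝ)..t, f s) (Icc 0 1) := by
  refine LipschitzOnWith.of_dist_le_mul fun x hx y hy => ?_
  have hx' : IntervalIntegrable f volume 0 x :=
    hf.mono_set (by rw [uIcc_of_le hx.1, uIcc_of_le zero_le_one]; exact Icc_subset_Icc_right hx.2)
  have hy' : IntervalIntegrable f volume 0 y :=
    hf.mono_set (by rw [uIcc_of_le hy.1, uIcc_of_le zero_le_one]; exact Icc_subset_Icc_right hy.2)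
  rw [dist_eq_norm, intervalIntegral.integral_interval_sub_left hx' hy', Real.dist_eq]
  refine intervalIntegral.norm_integral_le_of_norm_le_const_ae ?_
  filter_upwards [hb] with t ht h
  refine ht ?_
  have h3 := uIoc_subset_uIcc h
  exact (uIcc_subset_Icc hy hx) h3

theorem trajFst_spec (p : V × W) (u : CarnotControl V) :
    (∃ K : ℝ≥0, LipschitzOnWith K (trajFst p u) (Icc 0 1)) ∧
      ∀ᵐ t : ℝ, t ∈ Icc (0 : ℝ) 1 → HasDerivAt (trajFst p u) (u t) t := by
  have : CompleteSpace V := FiniteDimensional.complete ℝ V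
  refine ⟨⟨_, (LipschitzWith.const p.1).lipschitzOnWith.add (lipschitzOn_integral (norm_nonneg u)
    (intervalIntegrable_control u) (ae_norm_control_le u))⟩, ?_⟩
  filter_upwards [(intervalIntegrable_control u).ae_hasDerivAt_integral] with t ht h
  rw [← uIcc_of_le zero_le_one] at h
  exact (ht h 0 left_mem_uIcc).const_add p.1

theorem bracket_traj_spec (G : StepTwoCarnot V W) (p : V × W) (u : CarnotControl V) :
    IntervalIntegrable (fun s => G.bracket (trajFst p u s) (u s)) volume 0 1 ∧
      ∃ C : ℝ, 0 ≤ C ∧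
        ∀ᵐ t : ℝ, t ∈ Icc (0 : ℝ) 1 → ‖G.bracket (trajFst p u t) (u t)‖ ≤ C := by
  obtain ⟨⟨K, hK⟩, -⟩ := trajFst_spec p u
  let B : V →L[ℝ] V →L[ℝ] W := G.bracket.toContinuousBilinearMap
  have hB : ∀ x y, G.bracket x y = B x y := fun _ _ => rfl
  obtain ⟨M, hM⟩ := (isCompact_Icc.image_of_continuousOn hK.continuousOn).isBounded.exists_norm_le
  have hM' : ∀ t ∈ Icc (0 : ℝ) 1, ‖trajFst p u t‖ ≤ M := fun t ht => hM _ (mem_image_of_mem _ ht)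
  have hM0 : 0 ≤ M := (norm_nonneg _).trans (hM' 0 ⟨le_rfl, zero_le_one⟩)
  have hb : ∀ᵐ t : ℝ, t ∈ Icc (0 : ℝ) 1 →
      ‖G.bracket (trajFst p u t) (u t)‖ ≤ ‖B‖ * M * ‖u‖ := by
    filter_upwards [ae_norm_control_le u] with t ht h
    rw [hB]
    refine (B.le_opNorm₂ _ _).trans ?_
    have h1 := hM' t h
    have h2 := ht h
    gcongr
  refine ⟨?_, _, by positivity, hb⟩
  rw [intervalIntegrable_iff_integrableOn_Icc_of_le zero_le_one]
  have hmeas : AEStronglyMeasurable (fun s => B (trajFst p u s) (u s))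
      (volume.restrict (Icc (0 : ℝ) 1)) :=
    B.aestronglyMeasurable_comp₂ (hK.continuousOn.aestronglyMeasurable measurableSet_Icc)
      (Lp.aestronglyMeasurable u)
  exact Integrable.of_bound hmeas (‖B‖ * M * ‖u‖)
    ((ae_restrict_iff' measurableSet_Icc).2 hb)

theorem existsUnique_traj (G : StepTwoCarnot V W) (p : V × W) (u : CarnotControl V) :
    ((∃ K : ℝ≥0, LipschitzOnWith K (G.traj p u) (Icc 0 1)) ∧
      G.HasControlOn (G.traj p u) u 0 1 ∧ G.traj p u 0 = p) ∧
    ∀ γ : ℝ → V × W, (∃ K : ℝ≥0, LipschitzOnWith K γ (Icc 0 1)) → G.HasControlOn γ u 0 1 →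
      γ 0 = p → ∀ t ∈ Icc (0 : ℝ) 1, γ t = G.traj p u t := by
  have : CompleteSpace W := FiniteDimensional.complete ℝ W
  obtain ⟨⟨K, hK⟩, hx⟩ := trajFst_spec p u
  obtain ⟨hint, C, hC, hb⟩ := bracket_traj_spec G p u
  have hlip : ∃ K : ℝ≥0, LipschitzOnWith K (G.traj p u) (Icc 0 1) :=
    ⟨_, hK.prodMk ((LipschitzWith.const p.2).lipschitzOnWith.add
      ((lipschitzWith_smul (2⁻¹ : ℝ)).comp_lipschitzOnWith (lipschitzOn_integral hC hint hb)))⟩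
  have hder : ∀ᵐ t : ℝ, t ∈ Icc (0 : ℝ) 1 →
      HasDerivAt (G.traj p u) (G.field (u t) (G.traj p u t)) t := by
    filter_upwards [hx, hint.ae_hasDerivAt_integral] with t h1 h2 h
    have h' := h
    rw [← uIcc_of_le zero_le_one] at h'
    exact (h1 h).prodMk (((h2 h' 0 left_mem_uIcc).const_smul (2⁻¹ : ℝ)).const_add p.2)
  have h0 : G.traj p u 0 = p := by simp [traj, trajFst]
  refine ⟨⟨hlip, (ae_restrict_iff' measurableSet_Icc).2 hder, h0⟩, ?_⟩
  rintro γ ⟨L, hL⟩ hγ hγ0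
  have hγ' := (ae_restrict_iff' measurableSet_Icc).1 hγ
  obtain ⟨N, hN⟩ := hlip
  have hlipd : LipschitzOnWith (L + N) (fun t => γ t - G.traj p u t) (uIcc 0 1) := by
    rw [uIcc_of_le zero_le_one]; exact hL.sub hN
  have hfst : ∀ t ∈ Icc (0 : ℝ) 1, (γ t - G.traj p u t).1 = 0 := by
    have hl : LipschitzOnWith (1 * (L + N)) (fun t => (γ t - G.traj p u t).1) (uIcc 0 1) :=
      LipschitzWith.prod_fst.comp_lipschitzOnWith hlipd
    obtain ⟨c, hc⟩ := hl.absolutelyContinuousOnInterval.const_of_ae_hasDerivAt_zero (by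
      filter_upwards [hγ', hder] with t h1 h2 h
      rw [uIcc_of_le zero_le_one] at h
      have := (ContinuousLinearMap.fst ℝ V W).hasFDerivAt.comp_hasDerivAt t ((h1 h).sub (h2 h))
      simpa [field, Function.comp_def] using this)
    rw [uIcc_of_le zero_le_one] at hc
    intro t ht
    rw [hc t ht, ← hc 0 ⟨le_rfl, zero_le_one⟩, hγ0, h0, sub_self, Prod.fst_zero]
  have hall : ∀ t ∈ Icc (0 : ℝ) 1, γ t - G.traj p u t = 0 := by
    obtain ⟨c, hc⟩ := hlipd.absolutelyContinuousOnInterval.const_of_ae_hasDerivAt_zero (by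
      filter_upwards [hγ', hder] with t h1 h2 h
      rw [uIcc_of_le zero_le_one] at h
      have h3 := (h1 h).sub (h2 h)
      have h4 : (γ t).1 = (G.traj p u t).1 := sub_eq_zero.1 (hfst t h)
      have h5 : G.field (u t) (γ t) - G.field (u t) (G.traj p u t) = 0 := by
        simp [field, h4]
      rw [h5] at h3
      exact h3)
    rw [uIcc_of_le zero_le_one] at hc
    intro t ht
    rw [hc t ht, ← hc 0 ⟨le_rfl, zero_le_one⟩, hγ0, h0, sub_self]
  exact fun t ht => sub_eq_zero.1 (hall t ht)

end StepTwoCarnot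

end

/-!
The proof rests on one algebraic fact: since `J_v² = -‖v‖² S²`, one has `‖J_v x‖ = ‖v‖ ‖S x‖`
(`IsGenHType.norm_J_sq`), so `ker J_v = ker S` for every `v ≠ 0`, and `ker S` is the set of vectors
of the first layer which commute with everything.

*Abnormal curves.* The end-point map is a continuous quadratic polynomial on `L^∞`, hence
differentiable with an explicit differential (`hasFDerivAt_endpoint`). After an integration by
parts, a covector `(a, v)` annihilates this differential iff `c - J_v (∫₀ˢ u) = 0` for all `s`,
with a constant `c` depending on `a`, `v` (`covector_endpointDeriv`). Taking `s = 0` shows `c = 0`,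
so that `v ≠ 0` and the primitive of `u`, hence `u`, takes values in `ker J_v = ker S`. Conversely,
if `u ∈ ker S` a.e. then any `v ≠ 0` works, with `a = J_v (γ(0)₁) / 2`
(`IsGenHType.isAbnormal_iff`).

*Abnormal geodesics.* A curve with control in the central subspace `ker S` only moves in the first
layer, by the primitive of its control. The segment joining two of its points is horizontal too, and
by the equality case of the Cauchy-Schwarz inequality it is the only minimizer, so the curve is
locally, hence globally, affine (`IsGenHType.exists_eqOn_line`). Conversely the same inequality,
applied to the projections to the first layer, shows that these lines minimize the energy
(`IsHorizontalOn.le_energy`).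

*Normal extremals.* Along an extremal with initial covector `(u, v)` the second component of the
covector is conserved and the horizontal momentum `h` solves `h' = -J_v h`. When `u ∈ ker S`,
skew-symmetry of `J_v` makes `‖h - u‖` constant, so `h = u` and the extremal projects to the line
`t ↦ (t u, 0)` (`IsGenHType.eq_line_of_isNormalExtremal`). This uniqueness also evaluates the
exponential map.
-/

open Filter Topology

/-! ### Lipschitz curves in Euclidean spaces -/

section Calculus

theorem ae_mem_Ioo (a b : ℝ) : ∀ᵐ t ∂volume.restrict (Icc a b), t ∈ Ioo a b := by
  rw [← restrict_Ioo_eq_restrict_Icc]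
  exact ae_restrict_mem measurableSet_Ioo

theorem ae_Ioc_of_ae_Icc {P : ℝ → Prop} (h : ∀ᵐ s ∂volume.restrict (Icc (0 : ℝ) 1), P s) {t : ℝ}
    (ht : t ∈ Icc (0 : ℝ) 1) : ∀ᵐ s ∂volume.restrict (uIoc 0 t), P s := by
  rw [uIoc_of_le ht.1]
  exact ae_restrict_of_ae_restrict_of_subset
    (Ioc_subset_Icc_self.trans (Icc_subset_Icc_right ht.2)) h

/-- The fundamental theorem of calculus for Lipschitz curves in a Euclidean space. -/
theorem LipschitzOnWith.integral_of_ae_hasDerivAt {F : Type*} [NormedAddCommGroup F]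
    [InnerProductSpace ℝ F] [FiniteDimensional ℝ F] {f g : ℝ → F} {K : ℝ≥0} {a b : ℝ}
    (hab : a ≤ b) (hf : LipschitzOnWith K f (Icc a b))
    (hg : ∀ᵐ t ∂volume.restrict (Icc a b), HasDerivAt f (g t) t) :
    MemLp g ∞ (volume.restrict (Icc a b)) ∧ ∫ t in a..b, g t = f b - f a := by
  have : CompleteSpace F := FiniteDimensional.complete ℝ F
  have hmeas : AEStronglyMeasurable g (volume.restrict (Icc a b)) :=
    (stronglyMeasurable_deriv f).aestronglyMeasurable.congr (hg.mono fun t ht => ht.deriv)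
  have hmem : MemLp g ∞ (volume.restrict (Icc a b)) := by
    refine memLp_top_of_bound hmeas K ?_
    rw [← restrict_Ioo_eq_restrict_Icc] at hg ⊢
    filter_upwards [hg, ae_restrict_mem measurableSet_Ioo] with t ht htI
    simpa using ht.hasFDerivAt.le_of_lipschitzOn (Icc_mem_nhds htI.1 htI.2) hf
  refine ⟨hmem, ext_inner_left ℝ fun w => ?_⟩
  have hint : IntervalIntegrable g volume a b := by
    rw [intervalIntegrable_iff_integrableOn_Icc_of_le hab]
    exact hmem.integrable le_top
  have hlip : LipschitzOnWith (‖innerSL ℝ w‖₊ * K) (fun t => ⟪w, f t⟫) (uIcc a b) := by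
    rw [uIcc_of_le hab]
    exact (innerSL ℝ w).lipschitz.comp_lipschitzOnWith hf
  have h := hlip.absolutelyContinuousOnInterval.integral_deriv_eq_sub
  have h2 : ∫ t in a..b, deriv (fun t => ⟪w, f t⟫) t = ∫ t in a..b, ⟪w, g t⟫ := by
    refine intervalIntegral.integral_congr_ae_restrict ?_
    rw [uIoc_of_le hab]
    refine ae_restrict_of_ae_restrict_of_subset Ioc_subset_Icc_self ?_
    filter_upwards [hg] with t ht
    exact ((innerSL ℝ w).hasFDerivAt.comp_hasDerivAt t ht).deriv
  rw [inner_sub_right, ← h, h2]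
  exact ((innerSL ℝ w).intervalIntegral_comp_comm hint).symm

/-- A bounded bilinear map takes two Lipschitz curves on a compact interval to a Lipschitz curve. -/
theorem LipschitzOnWith.exists_clm_apply₂ {E F H : Type*} [NormedAddCommGroup E] [NormedSpace ℝ E]
    [NormedAddCommGroup F] [NormedSpace ℝ F] [NormedAddCommGroup H] [NormedSpace ℝ H]
    (B : E →L[ℝ] F →L[ℝ] H) {f : ℝ → E} {g : ℝ → F} {K L : ℝ≥0} {a b : ℝ}
    (hf : LipschitzOnWith K f (Icc a b)) (hg : LipschitzOnWith L g (Icc a b)) :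
    ∃ M, LipschitzOnWith M (fun t => B (f t) (g t)) (Icc a b) := by
  obtain ⟨C, hC⟩ := (isCompact_Icc.image_of_continuousOn hf.continuousOn).isBounded.exists_norm_le
  obtain ⟨D, hD⟩ := (isCompact_Icc.image_of_continuousOn hg.continuousOn).isBounded.exists_norm_le
  refine ⟨Real.toNNReal (‖B‖ * K * D + ‖B‖ * C * L), LipschitzOnWith.of_dist_le_mul
    fun x hx y hy => ?_⟩
  have h1 := hf.dist_le_mul x hx y hy
  have h2 := hg.dist_le_mul x hx y hy
  have h3 := hC _ (mem_image_of_mem f hy)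
  have h4 := hD _ (mem_image_of_mem g hx)
  have hC0 : 0 ≤ C := (norm_nonneg _).trans h3
  have hD0 : 0 ≤ D := (norm_nonneg _).trans h4
  rw [dist_eq_norm] at h1 h2 ⊢
  have hsplit : B (f x) (g x) - B (f y) (g y) = B (f x - f y) (g x) + B (f y) (g x - g y) := by
    simp
  rw [hsplit, Real.coe_toNNReal _ (by positivity)]
  calc ‖B (f x - f y) (g x) + B (f y) (g x - g y)‖
      ≤ ‖B‖ * ‖f x - f y‖ * ‖g x‖ + ‖B‖ * ‖f y‖ * ‖g x - g y‖ :=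
        (norm_add_le _ _).trans (add_le_add (B.le_opNorm₂ _ _) (B.le_opNorm₂ _ _))
    _ ≤ ‖B‖ * (K * dist x y) * D + ‖B‖ * C * (L * dist x y) := by gcongr
    _ = _ := by ring

/-- The identity behind the Cauchy-Schwarz inequality: the energy of `g` exceeds the energy of
its mean value `c` by the energy of `g - c`. -/
theorem integral_norm_sub_sq {F : Type*} [NormedAddCommGroup F] [InnerProductSpace ℝ F]
    [FiniteDimensional ℝ F] {g : ℝ → F} {a b : ℝ} (hab : a ≤ b)
    (hg : MemLp g ∞ (volume.restrict (Icc a b))) {c : F}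
    (hc : ∫ t in a..b, g t = (b - a) • c) :
    IntervalIntegrable (fun t => ‖g t - c‖ ^ 2) volume a b ∧
      ∫ t in a..b, ‖g t - c‖ ^ 2 = (∫ t in a..b, ‖g t‖ ^ 2) - (b - a) * ‖c‖ ^ 2 := by
  have : CompleteSpace F := FiniteDimensional.complete ℝ F
  have h2 : ∀ c : F, IntervalIntegrable (fun t => ‖g t - c‖ ^ 2) volume a b := fun c => by
    rw [intervalIntegrable_iff_integrableOn_Icc_of_le hab]
    exact ((hg.sub (memLp_const c)).mono_exponent le_top).integrable_norm_pow two_ne_zero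
  have hsq : IntervalIntegrable (fun t => ‖g t‖ ^ 2) volume a b := by simpa using h2 0
  have hint : IntervalIntegrable g volume a b := by
    rw [intervalIntegrable_iff_integrableOn_Icc_of_le hab]
    exact hg.integrable le_top
  have hin : IntervalIntegrable (fun t => ⟪c, g t⟫) volume a b := by
    rw [intervalIntegrable_iff_integrableOn_Icc_of_le hab]
    exact (innerSL ℝ c).integrable_comp (hg.integrable le_top)
  refine ⟨h2 c, ?_⟩
  have hinner : ∫ t in a..b, ⟪c, g t⟫ = (b - a) * ‖c‖ ^ 2 := by
    have := (innerSL ℝ c).intervalIntegral_comp_comm hint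
    simp only [innerSL_apply_apply] at this
    rw [this, hc, inner_smul_right, real_inner_self_eq_norm_sq]
  have hexp : ∀ t, ‖g t - c‖ ^ 2 = ‖g t‖ ^ 2 - 2 * ⟪c, g t⟫ + ‖c‖ ^ 2 := fun t => by
    rw [norm_sub_sq_real, real_inner_comm]
  simp only [hexp]
  rw [intervalIntegral.integral_add (hsq.sub (hin.const_mul 2)) intervalIntegrable_const,
    intervalIntegral.integral_sub hsq (hin.const_mul 2), intervalIntegral.integral_const_mul,
    hinner, intervalIntegral.integral_const, smul_eq_mul]
  ring

theorem eq_of_hasDerivWithinAt_zero {F : Type*} [NormedAddCommGroup F] [NormedSpace ℝ F]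
    {f : ℝ → F} (h : ∀ t ∈ Icc (0 : ℝ) 1, HasDerivWithinAt f 0 (Icc 0 1) t) :
    ∀ t ∈ Icc (0 : ℝ) 1, f t = f 0 :=
  constant_of_derivWithin_zero (fun t ht => (h t ht).differentiableWithinAt) fun t ht =>
    (h t (Ico_subset_Icc_self ht)).derivWithin
      ((uniqueDiffOn_Icc zero_lt_one) t (Ico_subset_Icc_self ht))

/-- A curve on `[0, 1]` which is affine near every point of `[0, 1]` is affine. -/
theorem eq_add_smul_of_locally_affine {F : Type*} [NormedAddCommGroup F] [NormedSpace ℝ F]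
    {f : ℝ → F}
    (h : ∀ t ∈ Icc (0 : ℝ) 1, ∃ c d : F, ∀ᶠ s in 𝓝[Icc 0 1] t, f s = d + s • c) :
    ∃ c : F, ∀ t ∈ Icc (0 : ℝ) 1, f t = f 0 + t • c := by
  choose! c d hcd using h
  have hder : ∀ t ∈ Icc (0 : ℝ) 1, HasDerivWithinAt f (c t) (Icc 0 1) t := fun t ht => by
    have h1 : HasDerivWithinAt (fun s : ℝ => d t + s • c t) (c t) (Icc 0 1) t := by
      simpa using (((hasDerivAt_id t).smul_const (c t)).const_add (d t)).hasDerivWithinAt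
    exact h1.congr_of_eventuallyEq (hcd t ht) ((hcd t ht).self_of_nhdsWithin ht)
  have hconst : ∀ t ∈ Icc (0 : ℝ) 1, ∀ᶠ s in 𝓝[Icc 0 1] t, c s = c t := fun t ht => by
    have h1 := eventually_eventually_nhdsWithin.2 (hcd t ht)
    filter_upwards [h1, self_mem_nhdsWithin] with s hs hsI
    have h2 : HasDerivWithinAt (fun s : ℝ => d t + s • c t) (c t) (Icc 0 1) s := by
      simpa using (((hasDerivAt_id s).smul_const (c t)).const_add (d t)).hasDerivWithinAt
    have h3 := h2.congr_of_eventuallyEq hs (hs.self_of_nhdsWithin hsI)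
    exact ((uniqueDiffOn_Icc zero_lt_one) s hsI).eq_deriv _ (hder s hsI) h3
  have hcc : ∀ t ∈ Icc (0 : ℝ) 1, c t = c 0 := eq_of_hasDerivWithinAt_zero fun t ht =>
    (hasDerivWithinAt_const t _ (c t)).congr_of_eventuallyEq (hconst t ht) rfl
  have hd : ∀ t ∈ Icc (0 : ℝ) 1,
      HasDerivWithinAt (fun s => f s - s • c 0) 0 (Icc 0 1) t := fun t ht => by
    have h1 := (hder t ht).fun_sub ((hasDerivAt_id t).smul_const (c 0)).hasDerivWithinAt
    rw [hcc t ht] at h1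
    simpa using h1
  refine ⟨c 0, fun t ht => ?_⟩
  have h3 := eq_of_hasDerivWithinAt_zero hd t ht
  simp only [zero_smul, sub_zero] at h3
  rw [← h3]
  abel

end Calculus

/-! ### The operators `J_v` and the kernel of `S` -/

namespace StepTwoCarnot

variable {V W : Type*} [NormedAddCommGroup V] [InnerProductSpace ℝ V] [FiniteDimensional ℝ V]
  [NormedAddCommGroup W] [InnerProductSpace ℝ W] [FiniteDimensional ℝ W]
  {G : StepTwoCarnot V W} {S : V →ₗ[ℝ] V}

theorem inner_J_left (G : StepTwoCarnot V W) (v : W) (x y : V) :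
    ⟪G.J v x, y⟫ = -⟪x, G.J v y⟫ := by
  rw [real_inner_comm, inner_J, inner_J, bracket_swap, inner_neg_right]

theorem inner_J_self (G : StepTwoCarnot V W) (v : W) (x : V) : ⟪G.J v x, x⟫ = 0 := by
  rw [real_inner_comm, inner_J, G.bracket_self, inner_zero_right]

/-- In a group of generalized H-type, `‖J_v x‖ = ‖v‖ ‖S x‖`. -/
theorem IsGenHType.norm_J_sq (hS : G.IsGenHType S) (v : W) (x : V) :
    ‖G.J v x‖ ^ 2 = ‖v‖ ^ 2 * ‖S x‖ ^ 2 := by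
  have h := LinearMap.congr_fun (hS.clifford v v) x
  simp only [LinearMap.add_apply, LinearMap.comp_apply, LinearMap.smul_apply] at h
  have h2 := congrArg (fun z => ⟪x, z⟫) h
  simp only [inner_add_right, inner_smul_right, real_inner_self_eq_norm_sq] at h2
  have h3 := G.inner_J_left v x (G.J v x)
  have h4 := hS.isPositive.isSymmetric x (S x)
  rw [real_inner_self_eq_norm_sq] at h3 h4
  rw [← h4] at h2
  linarith

theorem IsGenHType.J_eq_zero (hS : G.IsGenHType S) {x : V} (hx : x ∈ LinearMap.ker S) (v : W) :
    G.J v x = 0 := by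
  have h := hS.norm_J_sq v x
  rw [LinearMap.mem_ker.1 hx] at h
  simpa using h

theorem IsGenHType.mem_ker_of_J_eq_zero (hS : G.IsGenHType S) {v : W} (hv : v ≠ 0) {x : V}
    (hx : G.J v x = 0) : x ∈ LinearMap.ker S := by
  have h := hS.norm_J_sq v x
  rw [hx] at h
  simpa [hv] using h.symm

/-- The kernel of `S` consists of central elements. -/
theorem IsGenHType.bracket_right_eq_zero (hS : G.IsGenHType S) {x : V}
    (hx : x ∈ LinearMap.ker S) (y : V) : G.bracket y x = 0 :=
  ext_inner_left ℝ fun v => by rw [← inner_J, hS.J_eq_zero hx, inner_zero_right, inner_zero_right]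

end StepTwoCarnot

/-! ### The end-point map and abnormal curves -/

namespace StepTwoCarnot

variable {V W : Type*} [NormedAddCommGroup V] [InnerProductSpace ℝ V] [FiniteDimensional ℝ V]
  [NormedAddCommGroup W] [InnerProductSpace ℝ W] [FiniteDimensional ℝ W]
  {G : StepTwoCarnot V W} {S : V →ₗ[ℝ] V}

/-- The bracket as a bounded bilinear map. -/
noncomputable def bracketL (G : StepTwoCarnot V W) : V →L[ℝ] V →L[ℝ] W :=
  G.bracket.toContinuousBilinearMap

theorem bracketL_apply (G : StepTwoCarnot V W) (x y : V) : G.bracketL x y = G.bracket x y := rfl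

theorem intervalIntegrable_control_right (u : CarnotControl V) {t : ℝ} (ht : t ∈ Icc (0 : ℝ) 1) :
    IntervalIntegrable u volume 0 t :=
  (intervalIntegrable_control u).mono_set (by
    rw [uIcc_of_le ht.1, uIcc_of_le zero_le_one]; exact Icc_subset_Icc_right ht.2)

theorem integral_control_add (u h : CarnotControl V) {t : ℝ} (ht : t ∈ Icc (0 : ℝ) 1) :
    ∫ s in (0 : ℝ)..t, (u + h) s = (∫ s in (0 : ℝ)..t, u s) + ∫ s in (0 : ℝ)..t, h s := by
  rw [← intervalIntegral.integral_add (intervalIntegrable_control_right u ht)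
    (intervalIntegrable_control_right h ht)]
  exact intervalIntegral.integral_congr_ae_restrict (ae_Ioc_of_ae_Icc (Lp.coeFn_add u h) ht)

theorem integral_control_smul (c : ℝ) (u : CarnotControl V) {t : ℝ} (ht : t ∈ Icc (0 : ℝ) 1) :
    ∫ s in (0 : ℝ)..t, (c • u) s = c • ∫ s in (0 : ℝ)..t, u s := by
  rw [← intervalIntegral.integral_smul]
  exact intervalIntegral.integral_congr_ae_restrict (ae_Ioc_of_ae_Icc (Lp.coeFn_smul c u) ht)

theorem norm_integral_control_le (u : CarnotControl V) {t : ℝ} (ht : t ∈ Icc (0 : ℝ) 1) :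
    ‖∫ s in (0 : ℝ)..t, u s‖ ≤ ‖u‖ := by
  have h : ‖∫ s in (0 : ℝ)..t, u s‖ ≤ ‖u‖ * |t - 0| := by
    refine intervalIntegral.norm_integral_le_of_norm_le_const_ae ?_
    filter_upwards [ae_norm_control_le u] with s hs hsI
    rw [uIoc_of_le ht.1] at hsI
    exact hs ⟨hsI.1.le, hsI.2.trans ht.2⟩
  rw [sub_zero, abs_of_nonneg ht.1] at h
  exact h.trans (mul_le_of_le_one_right (norm_nonneg u) ht.2)

theorem lipschitzOn_integral_control (u : CarnotControl V) :
    ∃ K : ℝ≥0, LipschitzOnWith K (fun t => ∫ s in (0 : ℝ)..t, u s) (Icc 0 1) :=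
  ⟨_, lipschitzOn_integral (norm_nonneg u) (intervalIntegrable_control u) (ae_norm_control_le u)⟩

theorem hasDerivAt_integral_control (u : CarnotControl V) :
    ∀ᵐ t ∂volume.restrict (Icc (0 : ℝ) 1),
      HasDerivAt (fun t => ∫ s in (0 : ℝ)..t, u s) (u t) t := by
  have := (trajFst_spec (0 : V × V) u).2
  rw [ae_restrict_iff' measurableSet_Icc]
  have h0 : trajFst (0 : V × V) u = fun t => ∫ s in (0 : ℝ)..t, u s := by
    funext t
    simp [trajFst]
  filter_upwards [this] with t ht hI
  exact h0 ▸ ht hI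

theorem ae_norm_bracket_integral_le (G : StepTwoCarnot V W) (u h : CarnotControl V) :
    ∀ᵐ s ∂volume.restrict (Icc (0 : ℝ) 1),
      ‖G.bracket (∫ r in (0 : ℝ)..s, u r) (h s)‖ ≤ ‖G.bracketL‖ * ‖u‖ * ‖h‖ := by
  rw [ae_restrict_iff' measurableSet_Icc]
  filter_upwards [ae_norm_control_le h] with s hs hI
  rw [← bracketL_apply]
  refine (G.bracketL.le_opNorm₂ _ _).trans ?_
  have h1 := norm_integral_control_le u hI
  have h2 := hs hI
  gcongr

theorem intervalIntegrable_bracket_integral (G : StepTwoCarnot V W) (u h : CarnotControl V) :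
    IntervalIntegrable (fun s => G.bracket (∫ r in (0 : ℝ)..s, u r) (h s)) volume 0 1 := by
  obtain ⟨K, hK⟩ := lipschitzOn_integral_control u
  rw [intervalIntegrable_iff_integrableOn_Icc_of_le zero_le_one]
  exact Integrable.of_bound (G.bracketL.aestronglyMeasurable_comp₂
    (hK.continuousOn.aestronglyMeasurable measurableSet_Icc) (Lp.aestronglyMeasurable h))
    _ (ae_norm_bracket_integral_le G u h)

/-- The bounded linear map sending a control to its integral over `[0, 1]`. -/
noncomputable def integralL : CarnotControl V →L[ℝ] V :=
  LinearMap.mkContinuous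
    { toFun := fun u => ∫ s in (0 : ℝ)..1, u s
      map_add' := fun u h => integral_control_add u h (right_mem_Icc.2 zero_le_one)
      map_smul' := fun c u => integral_control_smul c u (right_mem_Icc.2 zero_le_one) } 1
    fun u => by simpa using norm_integral_control_le u (right_mem_Icc.2 zero_le_one)

theorem integralL_apply (u : CarnotControl V) : integralL u = ∫ s in (0 : ℝ)..1, u s := rfl

/-- The bounded bilinear map `(u, h) ↦ ∫₀¹ [∫₀ˢ u, h(s)] ds` on controls. Its diagonal is the
quadratic part of the end-point map. -/
noncomputable def areaL (G : StepTwoCarnot V W) :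
    CarnotControl V →L[ℝ] CarnotControl V →L[ℝ] W :=
  LinearMap.mkContinuous₂
    (LinearMap.mk₂ ℝ (fun u h => ∫ s in (0 : ℝ)..1, G.bracket (∫ r in (0 : ℝ)..s, u r) (h s))
      (fun u u' h => by
        rw [← intervalIntegral.integral_add (intervalIntegrable_bracket_integral G u h)
          (intervalIntegrable_bracket_integral G u' h)]
        refine intervalIntegral.integral_congr fun s hs => ?_
        rw [uIcc_of_le zero_le_one] at hs
        simp only [integral_control_add u u' hs, map_add, LinearMap.add_apply])
      (fun c u h => by
        rw [← intervalIntegral.integral_smul]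
        refine intervalIntegral.integral_congr fun s hs => ?_
        rw [uIcc_of_le zero_le_one] at hs
        simp only [integral_control_smul c u hs, map_smul, LinearMap.smul_apply])
      (fun u h h' => by
        rw [← intervalIntegral.integral_add (intervalIntegrable_bracket_integral G u h)
          (intervalIntegrable_bracket_integral G u h')]
        refine intervalIntegral.integral_congr_ae_restrict ?_
        filter_upwards [ae_Ioc_of_ae_Icc (Lp.coeFn_add h h') (right_mem_Icc.2 zero_le_one)]
          with s hs
        rw [hs, Pi.add_apply, map_add])
      (fun c u h => by
        rw [← intervalIntegral.integral_smul]
        refine intervalIntegral.integral_congr_ae_restrict ?_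
        filter_upwards [ae_Ioc_of_ae_Icc (Lp.coeFn_smul c h) (right_mem_Icc.2 zero_le_one)]
          with s hs
        rw [hs, Pi.smul_apply, map_smul]))
    ‖G.bracketL‖ fun u h => by
      have := intervalIntegral.norm_integral_le_of_norm_le_const_ae (a := 0) (b := 1)
        (f := fun s => G.bracket (∫ r in (0 : ℝ)..s, u r) (h s))
        (C := ‖G.bracketL‖ * ‖u‖ * ‖h‖) (by
          filter_upwards [(ae_restrict_iff' measurableSet_Icc).1
            (ae_norm_bracket_integral_le G u h)] with s hs hI
          rw [uIoc_of_le zero_le_one] at hI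
          exact hs (Ioc_subset_Icc_self hI))
      simpa using this

theorem areaL_apply (G : StepTwoCarnot V W) (u h : CarnotControl V) :
    G.areaL u h = ∫ s in (0 : ℝ)..1, G.bracket (∫ r in (0 : ℝ)..s, u r) (h s) := rfl

/-- Integration by parts: exchanging the two arguments of `areaL` costs a boundary term. -/
theorem areaL_swap (G : StepTwoCarnot V W) (u h : CarnotControl V) :
    G.areaL h u = G.areaL u h + G.bracket (integralL h) (integralL u) := by
  obtain ⟨K, hK⟩ := lipschitzOn_integral_control h
  obtain ⟨L, hL⟩ := lipschitzOn_integral_control u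
  obtain ⟨M, hM⟩ := hK.exists_clm_apply₂ G.bracketL hL
  have hder : ∀ᵐ t ∂volume.restrict (Icc (0 : ℝ) 1),
      HasDerivAt (fun t => G.bracketL (∫ s in (0 : ℝ)..t, h s) (∫ s in (0 : ℝ)..t, u s))
        (G.bracket (∫ s in (0 : ℝ)..t, h s) (u t) - G.bracket (∫ s in (0 : ℝ)..t, u s) (h t))
        t := by
    filter_upwards [hasDerivAt_integral_control h,
      hasDerivAt_integral_control u] with t h1 h2
    have h3 := G.bracketL.hasDerivAt_of_bilinear (u := fun t => ∫ s in (0 : ℝ)..t, h s)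
      (v := fun t => ∫ s in (0 : ℝ)..t, u s) (fun _ => h1) (fun _ => h2)
    rwa [bracketL_apply, bracketL_apply, G.bracket_swap _ (h t), ← sub_eq_add_neg] at h3
  have hFTC := (hM.integral_of_ae_hasDerivAt zero_le_one hder).2
  rw [intervalIntegral.integral_sub (intervalIntegrable_bracket_integral G h u)
    (intervalIntegrable_bracket_integral G u h), ← areaL_apply, ← areaL_apply] at hFTC
  simp only [intervalIntegral.integral_same, map_zero, sub_zero] at hFTC
  rw [integralL_apply, integralL_apply, ← bracketL_apply, ← hFTC]
  abel

theorem endpoint_eq (G : StepTwoCarnot V W) (p : V × W) (u : CarnotControl V) :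
    G.endpoint p u = (p.1 + integralL u,
      p.2 + (2⁻¹ : ℝ) • (G.bracketL p.1 (integralL u) + G.areaL u u)) := by
  have : CompleteSpace V := FiniteDimensional.complete ℝ V
  have : CompleteSpace W := FiniteDimensional.complete ℝ W
  have h1 : IntervalIntegrable (fun s => G.bracketL p.1 (u s)) volume 0 1 := by
    have := intervalIntegrable_control u
    rw [intervalIntegrable_iff_integrableOn_Icc_of_le zero_le_one] at this ⊢
    exact (G.bracketL p.1).integrable_comp this
  rw [integralL_apply, ← (G.bracketL p.1).intervalIntegral_comp_comm (intervalIntegrable_control u),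
    areaL_apply, ← intervalIntegral.integral_add h1 (intervalIntegrable_bracket_integral G u u)]
  simp [endpoint, traj, trajFst, bracketL_apply]

/-- The differential at `u` of the end-point map with base point `p`. -/
noncomputable def endpointDeriv (G : StepTwoCarnot V W) (p : V × W) (u : CarnotControl V) :
    CarnotControl V →L[ℝ] V × W :=
  integralL.prod ((2⁻¹ : ℝ) • (G.bracketL p.1 ∘L integralL + (G.areaL u + G.areaL.flip u)))

theorem endpointDeriv_apply (G : StepTwoCarnot V W) (p : V × W) (u h : CarnotControl V) :
    G.endpointDeriv p u h = (integralL h,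
      (2⁻¹ : ℝ) • (G.bracket p.1 (integralL h) + (G.areaL u h + G.areaL h u))) := rfl

theorem hasFDerivAt_endpoint (G : StepTwoCarnot V W) (p : V × W) (u : CarnotControl V) :
    HasFDerivAt (G.endpoint p) (G.endpointDeriv p u) u := by
  rw [funext (G.endpoint_eq p)]
  refine HasFDerivAt.prodMk (integralL.hasFDerivAt.const_add _) (HasFDerivAt.const_add _
    (HasFDerivAt.const_smul (HasFDerivAt.fun_add ?_ ?_) _))
  · exact ((G.bracketL p.1) ∘L integralL).hasFDerivAt
  · have := G.areaL.hasFDerivAt_of_bilinear (hasFDerivAt_id u) (hasFDerivAt_id u)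
    refine this.congr_fderiv (ContinuousLinearMap.ext fun h => ?_)
    simp

theorem covector_apply (a : V) (v : W) (q : V × W) :
    covector a v q = ⟪a, q.1⟫ + ⟪v, q.2⟫ := rfl

theorem exists_eq_covector (l : V × W →L[ℝ] ℝ) : ∃ (a : V) (v : W), l = covector a v := by
  have : CompleteSpace V := FiniteDimensional.complete ℝ V
  have : CompleteSpace W := FiniteDimensional.complete ℝ W
  refine ⟨(InnerProductSpace.toDual ℝ V).symm (l ∘L ContinuousLinearMap.inl ℝ V W),
    (InnerProductSpace.toDual ℝ W).symm (l ∘L ContinuousLinearMap.inr ℝ V W), ?_⟩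
  ext q <;> simp [covector_apply]

theorem integral_control_mem_ker {u : CarnotControl V}
    (hu : ∀ᵐ t ∂volume.restrict (Icc (0 : ℝ) 1), u t ∈ LinearMap.ker S) {t : ℝ}
    (ht : t ∈ Icc (0 : ℝ) 1) : ∫ s in (0 : ℝ)..t, u s ∈ LinearMap.ker S := by
  have : CompleteSpace V := FiniteDimensional.complete ℝ V
  have h := (LinearMap.toContinuousLinearMap S).intervalIntegral_comp_comm
    (intervalIntegrable_control_right u ht)
  rw [LinearMap.mem_ker]
  refine h.symm.trans (intervalIntegral.integral_zero_ae ?_)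
  have := ae_Ioc_of_ae_Icc hu ht
  rw [ae_restrict_iff' measurableSet_uIoc] at this
  filter_upwards [this] with s hs hI using hs hI

/-- The pull-back of the covector `(a, v)` by the differential of the end-point map is the `L²`
pairing with `s ↦ c - J_v (∫₀ˢ u)`, for a constant `c`: all dependence on the variation `h` through
its primitive is removed by `areaL_swap`. -/
theorem covector_endpointDeriv (G : StepTwoCarnot V W) (p : V × W) (u h : CarnotControl V)
    (a : V) (v : W) :
    covector a v (G.endpointDeriv p u h) =
      ∫ s in (0 : ℝ)..1, ⟪a - (2⁻¹ : ℝ) • G.J v p.1 + (2⁻¹ : ℝ) • G.J v (integralL u)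
        - G.J v (∫ r in (0 : ℝ)..s, u r), h s⟫ := by
  have : CompleteSpace V := FiniteDimensional.complete ℝ V
  have : CompleteSpace W := FiniteDimensional.complete ℝ W
  have hJ : ∀ x y : V, ⟪v, G.bracket x y⟫ = -⟪G.J v x, y⟫ := fun x y => by
    rw [inner_J_left, neg_neg, inner_J]
  have hI := intervalIntegrable_bracket_integral G u h
  have h1 : ⟪v, G.areaL u h⟫ = ∫ s in (0 : ℝ)..1, -⟪G.J v (∫ r in (0 : ℝ)..s, u r), h s⟫ := by
    have := (innerSL ℝ v).intervalIntegral_comp_comm hI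
    simp only [innerSL_apply_apply, hJ] at this
    rw [this, areaL_apply]
  have h1i : IntervalIntegrable (fun s => -⟪G.J v (∫ r in (0 : ℝ)..s, u r), h s⟫) volume 0 1 := by
    rw [intervalIntegrable_iff_integrableOn_Icc_of_le zero_le_one] at hI ⊢
    have := (innerSL ℝ v).integrable_comp hI
    simpa only [IntegrableOn, innerSL_apply_apply, hJ] using this
  have h2i : ∀ c : V, IntervalIntegrable (fun s => ⟪c, h s⟫) volume 0 1 := fun c => by
    have := intervalIntegrable_control h
    rw [intervalIntegrable_iff_integrableOn_Icc_of_le zero_le_one] at this ⊢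
    exact (innerSL ℝ c).integrable_comp this
  have h2 : ∀ c : V, ⟪c, integralL h⟫ = ∫ s in (0 : ℝ)..1, ⟪c, h s⟫ := fun c =>
    ((innerSL ℝ c).intervalIntegral_comp_comm (intervalIntegrable_control h)).symm
  simp only [inner_sub_left (𝕜 := ℝ) _ (G.J v (∫ r in (0 : ℝ)..(_ : ℝ), u r)), sub_eq_add_neg
    (⟪_, h _⟫ : ℝ)]
  rw [intervalIntegral.integral_add (h2i _) h1i, ← h1, ← h2, covector_apply, endpointDeriv_apply]
  simp only [inner_smul_right, inner_add_right, areaL_swap G u h, hJ, inner_add_left,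
    inner_sub_left, real_inner_smul_left]
  rw [G.inner_J_left v (integralL h), real_inner_comm (integralL h) (G.J v (integralL u))]
  ring

/-- Abnormal curves in a group of generalized H-type are the horizontal curves
whose control takes values in `ker S`. -/
theorem IsGenHType.isAbnormal_iff (hS : G.IsGenHType S) (γ : ℝ → V × W) :
    G.IsAbnormal γ ↔ (∃ K : ℝ≥0, LipschitzOnWith K γ (Icc 0 1)) ∧
      ∃ u : CarnotControl V, G.HasControlOn γ u 0 1 ∧
        ∀ᵐ t ∂volume.restrict (Icc (0 : ℝ) 1), u t ∈ LinearMap.ker S := by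
  constructor
  · rintro ⟨⟨hlip, -⟩, u, hu, D, hD, l, hl, hlD⟩
    refine ⟨hlip, u, hu, ?_⟩
    rw [hD.unique (G.hasFDerivAt_endpoint _ u)] at hlD
    obtain ⟨a, v, rfl⟩ := exists_eq_covector l
    set c := a - (2⁻¹ : ℝ) • G.J v (γ 0).1 + (2⁻¹ : ℝ) • G.J v (integralL u) with hc
    have hzero : ∀ h : CarnotControl V,
        ∫ s in (0 : ℝ)..1, ⟪c - G.J v (∫ r in (0 : ℝ)..s, u r), h s⟫ = 0 := fun h => by
      rw [← covector_endpointDeriv]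
      exact DFunLike.congr_fun hlD h
    obtain ⟨K, hK⟩ := lipschitzOn_integral_control u
    have hcont : ContinuousOn (fun s => c - G.J v (∫ r in (0 : ℝ)..s, u r)) (Icc 0 1) :=
      continuousOn_const.sub
        ((LinearMap.continuous_of_finiteDimensional (G.J v)).comp_continuousOn hK.continuousOn)
    obtain ⟨C, hC⟩ := (isCompact_Icc.image_of_continuousOn hcont).isBounded.exists_norm_le
    have hmem : MemLp (fun s => c - G.J v (∫ r in (0 : ℝ)..s, u r)) ∞
        (volume.restrict (Icc 0 1)) :=
      memLp_top_of_bound (hcont.aestronglyMeasurable measurableSet_Icc) C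
        ((ae_restrict_iff' measurableSet_Icc).2 (Eventually.of_forall fun s hs =>
          hC _ (mem_image_of_mem _ hs)))
    -- The function annihilated by all controls is bounded, hence is itself an admissible control.
    have hsq : ∫ s in (0 : ℝ)..1, ‖c - G.J v (∫ r in (0 : ℝ)..s, u r)‖ ^ 2 = 0 := by
      refine Eq.trans ?_ (hzero (hmem.toLp _))
      refine intervalIntegral.integral_congr_ae_restrict ?_
      filter_upwards [ae_Ioc_of_ae_Icc hmem.coeFn_toLp (right_mem_Icc.2 zero_le_one)] with s hs
      rw [hs, real_inner_self_eq_norm_sq]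
    have hEq : ∀ s ∈ Icc (0 : ℝ) 1, c - G.J v (∫ r in (0 : ℝ)..s, u r) = 0 := by
      rw [intervalIntegral.integral_of_le zero_le_one, ← integral_Icc_eq_integral_Ioc,
        integral_eq_zero_iff_of_nonneg (fun s => by positivity)
          ((hmem.mono_exponent le_top).integrable_norm_pow two_ne_zero)] at hsq
      refine Measure.eqOn_Icc_of_ae_eq volume zero_ne_one ?_ hcont continuousOn_const
      filter_upwards [hsq] with s hs
      simpa using hs
    have hc0 : c = 0 := by simpa using hEq 0 (left_mem_Icc.2 zero_le_one)
    have hv : v ≠ 0 := by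
      rintro rfl
      have hJ0 : ∀ x, G.J 0 x = 0 := fun x => ext_inner_left ℝ fun y => by
        rw [inner_J, inner_zero_left, inner_zero_right]
      have ha : a = 0 := by simpa [hc, hJ0] using hc0
      exact hl (by ext q <;> simp [ha, covector_apply])
    have hI : ∀ s ∈ Icc (0 : ℝ) 1, G.J v (∫ r in (0 : ℝ)..s, u r) = 0 := fun s hs => by
      simpa [hc0] using hEq s hs
    filter_upwards [hasDerivAt_integral_control u, ae_mem_Ioo 0 1] with t ht htI
    refine hS.mem_ker_of_J_eq_zero hv ?_
    have h1 := (LinearMap.toContinuousLinearMap (G.J v)).hasFDerivAt.comp_hasDerivAt t ht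
    have h2 : HasDerivAt (fun _ : ℝ => (0 : V)) (G.J v (u t)) t := h1.congr_of_eventuallyEq (by
      filter_upwards [Icc_mem_nhds htI.1 htI.2] with s hs using (hI s hs).symm)
    exact h2.unique (hasDerivAt_const t 0)
  · rintro ⟨hlip, u, hu, hker⟩
    refine ⟨⟨hlip, hu.mono fun t ht => ⟨_, ht⟩⟩, u, hu, _, G.hasFDerivAt_endpoint _ u, ?_⟩
    have := G.nontrivial_snd
    obtain ⟨v, hv⟩ := exists_ne (0 : W)
    refine ⟨covector ((2⁻¹ : ℝ) • G.J v (γ 0).1) v, fun h0 => ?_, ?_⟩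
    · have := DFunLike.congr_fun h0 (0, v)
      simp [covector_apply, hv] at this
    · ext h
      rw [ContinuousLinearMap.comp_apply, covector_endpointDeriv]
      refine (intervalIntegral.integral_congr fun s hs => ?_).trans
        intervalIntegral.integral_zero
      rw [uIcc_of_le zero_le_one] at hs
      have h1 : G.J v (integralL u) = 0 :=
        hS.J_eq_zero (integral_control_mem_ker hker (right_mem_Icc.2 zero_le_one)) v
      have h2 := hS.J_eq_zero (integral_control_mem_ker hker hs) v
      simp [h1, h2]

end StepTwoCarnot

/-! ### Energy, lines and abnormal geodesics -/

namespace StepTwoCarnot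

variable {V W : Type*} [NormedAddCommGroup V] [InnerProductSpace ℝ V] [FiniteDimensional ℝ V]
  [NormedAddCommGroup W] [InnerProductSpace ℝ W] [FiniteDimensional ℝ W]
  {G : StepTwoCarnot V W} {S : V →ₗ[ℝ] V}

theorem HasControlOn.congr {γ η : ℝ → V × W} {u : ℝ → V} {a b : ℝ} (h : G.HasControlOn η u a b)
    (heq : EqOn γ η (Icc a b)) : G.HasControlOn γ u a b := by
  filter_upwards [h, ae_mem_Ioo a b] with t ht htI
  have hev : γ =ᶠ[𝓝 t] η := heq.eventuallyEq_of_mem (Icc_mem_nhds htI.1 htI.2)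
  rw [hev.eq_of_nhds]
  exact ht.congr_of_eventuallyEq hev

theorem IsHorizontalOn.congr {γ η : ℝ → V × W} {a b : ℝ} (h : G.IsHorizontalOn η a b)
    (heq : EqOn γ η (Icc a b)) : G.IsHorizontalOn γ a b := by
  refine ⟨h.1.imp fun K hK x hx y hy => by rw [heq hx, heq hy]; exact hK hx hy, ?_⟩
  filter_upwards [h.2, ae_mem_Ioo a b] with t ht htI
  have hev : γ =ᶠ[𝓝 t] η := heq.eventuallyEq_of_mem (Icc_mem_nhds htI.1 htI.2)
  rw [hev.eq_of_nhds]
  exact ht.imp fun w hw => hw.congr_of_eventuallyEq hev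

theorem energy_congr {γ η : ℝ → V × W} {a b : ℝ} (hab : a ≤ b) (heq : EqOn γ η (Icc a b)) :
    G.energy γ a b = G.energy η a b := by
  rw [energy, energy]
  congr 1
  refine intervalIntegral.integral_congr_ae_restrict ?_
  rw [uIoc_of_le hab]
  refine ae_restrict_of_ae_restrict_of_subset Ioc_subset_Icc_self ?_
  filter_upwards [ae_mem_Ioo a b] with t htI
  rw [(heq.eventuallyEq_of_mem (Icc_mem_nhds htI.1 htI.2)).deriv_eq]

theorem IsHorizontalOn.mono {γ : ℝ → V × W} {a b c d : ℝ} (h : G.IsHorizontalOn γ a b)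
    (hs : Icc c d ⊆ Icc a b) : G.IsHorizontalOn γ c d :=
  ⟨h.1.imp fun _ hK => hK.mono hs, ae_restrict_of_ae_restrict_of_subset hs h.2⟩

theorem IsHorizontalOn.integral_fst_deriv {γ : ℝ → V × W} {a b : ℝ} (hab : a ≤ b)
    (h : G.IsHorizontalOn γ a b) :
    MemLp (fun t => (deriv γ t).1) ∞ (volume.restrict (Icc a b)) ∧
      ∫ t in a..b, (deriv γ t).1 = (γ b).1 - (γ a).1 := by
  obtain ⟨⟨K, hK⟩, hd⟩ := h
  refine (LipschitzWith.prod_fst.comp_lipschitzOnWith hK).integral_of_ae_hasDerivAt hab ?_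
  filter_upwards [hd] with t ⟨w, ht⟩
  exact (ContinuousLinearMap.fst ℝ V W).hasFDerivAt.comp_hasDerivAt t
    ht.differentiableAt.hasDerivAt

/-- A horizontal curve whose projection to the first layer has mean velocity `c` has at least the
energy of the segment with velocity `c`. -/
theorem IsHorizontalOn.le_energy {γ : ℝ → V × W} {a b : ℝ} (hab : a ≤ b)
    (h : G.IsHorizontalOn γ a b) {c : V} (hc : (γ b).1 - (γ a).1 = (b - a) • c) :
    2⁻¹ * ((b - a) * ‖c‖ ^ 2) ≤ G.energy γ a b := by
  obtain ⟨hm, hi⟩ := h.integral_fst_deriv hab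
  have h1 := (integral_norm_sub_sq hab hm (hi.trans hc)).2
  have h2 : 0 ≤ ∫ t in a..b, ‖(deriv γ t).1 - c‖ ^ 2 :=
    intervalIntegral.integral_nonneg hab fun t _ => by positivity
  rw [energy]
  linarith

/-- The equality case of `IsHorizontalOn.le_energy`. -/
theorem IsHorizontalOn.fst_eq_of_energy_le {γ : ℝ → V × W} {a b : ℝ} (hab : a ≤ b)
    (h : G.IsHorizontalOn γ a b) {c : V} (hc : (γ b).1 - (γ a).1 = (b - a) • c)
    (hE : G.energy γ a b ≤ 2⁻¹ * ((b - a) * ‖c‖ ^ 2)) :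
    ∀ s ∈ Icc a b, (γ s).1 = (γ a).1 + (s - a) • c := by
  have : CompleteSpace V := FiniteDimensional.complete ℝ V
  obtain ⟨hm, hi⟩ := h.integral_fst_deriv hab
  obtain ⟨hint, h1⟩ := integral_norm_sub_sq hab hm (hi.trans hc)
  have h2 : ∫ t in a..b, ‖(deriv γ t).1 - c‖ ^ 2 = 0 := by
    refine le_antisymm ?_ (intervalIntegral.integral_nonneg hab fun t _ => by positivity)
    rw [energy] at hE
    linarith
  rw [intervalIntegral.integral_eq_zero_iff_of_le_of_nonneg_ae hab
    (Eventually.of_forall fun t => by positivity) hint] at h2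
  intro s hs
  have h3 := ((h.mono (Icc_subset_Icc_right hs.2)).integral_fst_deriv hs.1).2
  have h4 : ∫ t in a..s, (deriv γ t).1 = ∫ t in a..s, c := by
    refine intervalIntegral.integral_congr_ae_restrict ?_
    rw [uIoc_of_le hs.1]
    refine ae_restrict_of_ae_restrict_of_subset (Ioc_subset_Ioc_right hs.2) ?_
    filter_upwards [h2] with t ht
    simpa [sub_eq_zero] using ht
  rw [h4, intervalIntegral.integral_const] at h3
  rw [h3]
  abel

/-- The affine curve `s ↦ (q + s c, z)`. -/
def line (q c : V) (z : W) (s : ℝ) : V × W := (q + s • c, z)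

theorem hasDerivAt_line (q c : V) (z : W) (t : ℝ) : HasDerivAt (line q c z) (c, 0) t := by
  refine HasDerivAt.prodMk ?_ (hasDerivAt_const t z)
  simpa using ((hasDerivAt_id t).smul_const c).const_add q

theorem lipschitzWith_line (q c : V) (z : W) : LipschitzWith ‖c‖₊ (line q c z) := by
  refine LipschitzWith.of_dist_le_mul fun s t => ?_
  have h : line q c z s - line q c z t = ((s - t) • c, 0) := by
    simp [line, sub_smul]
  rw [dist_eq_norm, h, Prod.norm_mk, norm_smul, norm_zero, Real.dist_eq, coe_nnnorm,
    max_eq_left (by positivity), Real.norm_eq_abs, mul_comm]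

theorem energy_line (q c : V) (z : W) (a b : ℝ) :
    G.energy (line q c z) a b = 2⁻¹ * ((b - a) * ‖c‖ ^ 2) := by
  simp [energy, (hasDerivAt_line q c z _).deriv]

/-- Horizontality of the lines with velocity in the center. -/
theorem IsGenHType.hasDerivAt_line (hS : G.IsGenHType S) (q : V) {c : V}
    (hc : c ∈ LinearMap.ker S) (z : W) (t : ℝ) :
    HasDerivAt (line q c z) (G.field c (line q c z t)) t := by
  rw [field, hS.bracket_right_eq_zero hc, smul_zero]
  exact StepTwoCarnot.hasDerivAt_line q c z t

theorem IsGenHType.isHorizontalOn_line (hS : G.IsGenHType S) (q : V) {c : V}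
    (hc : c ∈ LinearMap.ker S) (z : W) (a b : ℝ) : G.IsHorizontalOn (line q c z) a b :=
  ⟨⟨_, (lipschitzWith_line q c z).lipschitzOnWith⟩,
    Eventually.of_forall fun t => ⟨c, hS.hasDerivAt_line q hc z t⟩⟩

theorem IsGenHType.mul_eq_line (hS : G.IsGenHType S) (p : V × W) {c : V}
    (hc : c ∈ LinearMap.ker S) (t : ℝ) : G.mul p (t • c, 0) = line p.1 c p.2 t := by
  simp [mul, line, hS.bracket_right_eq_zero hc]

theorem IsGenHType.isGeodesic_of_eqOn_line (hS : G.IsGenHType S) {q : V} {c : V}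
    (hc : c ∈ LinearMap.ker S) {z : W} {γ : ℝ → V × W} (hγ : EqOn γ (line q c z) (Icc 0 1)) :
    G.IsGeodesic γ := by
  refine ⟨(hS.isHorizontalOn_line q hc z 0 1).congr hγ, fun t _ => ⟨1, one_pos, ?_⟩⟩
  intro a b ha hab hb _ _ η hη hηa hηb
  rw [energy_congr hab (hγ.mono (Icc_subset_Icc ha hb)), energy_line]
  refine hη.le_energy hab ?_
  rw [hηa, hηb, hγ ⟨ha.trans hab, hb⟩, hγ ⟨ha, hab.trans hb⟩]
  simp [line, sub_smul]

theorem IsGenHType.isAbnormal_of_eqOn_line (hS : G.IsGenHType S) {q : V} {c : V}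
    (hc : c ∈ LinearMap.ker S) {z : W} {γ : ℝ → V × W} (hγ : EqOn γ (line q c z) (Icc 0 1)) :
    G.IsAbnormal γ := by
  have hu := (memLp_const (p := ∞) (μ := volume.restrict (Icc (0 : ℝ) 1)) c).coeFn_toLp
  refine (hS.isAbnormal_iff γ).2 ⟨((hS.isHorizontalOn_line q hc z 0 1).congr hγ).1,
    (memLp_const c).toLp _, HasControlOn.congr ?_ hγ, ?_⟩
  · filter_upwards [hu] with t ht
    rw [ht]
    exact hS.hasDerivAt_line q hc z t
  · filter_upwards [hu] with t ht
    rwa [ht]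

/-- A horizontal curve with control in the center does not move in the second layer. -/
theorem IsGenHType.eq_of_control_mem_ker (hS : G.IsGenHType S) {γ : ℝ → V × W}
    (hlip : ∃ K : ℝ≥0, LipschitzOnWith K γ (Icc 0 1)) {u : CarnotControl V}
    (hu : G.HasControlOn γ u 0 1)
    (hker : ∀ᵐ t ∂volume.restrict (Icc (0 : ℝ) 1), u t ∈ LinearMap.ker S) {t : ℝ}
    (ht : t ∈ Icc (0 : ℝ) 1) : γ t = ((γ 0).1 + ∫ s in (0 : ℝ)..t, u s, (γ 0).2) := by
  rw [(G.existsUnique_traj (γ 0) u).2 γ hlip hu rfl t ht, traj, trajFst]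
  have h : ∫ s in (0 : ℝ)..t, G.bracket (trajFst (γ 0) u s) (u s) = 0 := by
    refine (intervalIntegral.integral_congr_ae_restrict ?_).trans intervalIntegral.integral_zero
    filter_upwards [ae_Ioc_of_ae_Icc hker ht] with s hs
    exact hS.bracket_right_eq_zero hs _
  rw [h, smul_zero, add_zero]

theorem IsGenHType.exists_eqOn_line (hS : G.IsGenHType S) {γ : ℝ → V × W}
    (hab : G.IsAbnormal γ) (hgeo : G.IsGeodesic γ) :
    ∃ c ∈ LinearMap.ker S, EqOn γ (line (γ 0).1 c (γ 0).2) (Icc 0 1) := by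
  obtain ⟨hlip, u, hu, hker⟩ := (hS.isAbnormal_iff γ).1 hab
  have hγ := fun t (ht : t ∈ Icc (0 : ℝ) 1) => hS.eq_of_control_mem_ker hlip hu hker ht
  have hloc : ∀ t ∈ Icc (0 : ℝ) 1, ∃ c d : V,
      ∀ᶠ s in 𝓝[Icc 0 1] t, (γ s).1 = d + s • c := fun t ht => by
    obtain ⟨ε, hε, hmin⟩ := hgeo.2 t ht
    set a := max 0 (t - ε / 2) with ha
    set b := min 1 (t + ε / 2) with hb
    have ha0 : 0 ≤ a := le_max_left _ _
    have hb1 : b ≤ 1 := min_le_left _ _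
    have hat : a ≤ t := max_le ht.1 (by linarith)
    have htb : t ≤ b := le_min ht.2 (by linarith)
    have hab : a < b :=
      lt_min (max_lt one_pos (by linarith [ht.2])) (max_lt (by linarith [ht.1]) (by linarith))
    have haI : a ∈ Icc (0 : ℝ) 1 := ⟨ha0, hab.le.trans hb1⟩
    have hbI : b ∈ Icc (0 : ℝ) 1 := ⟨ha0.trans hab.le, hb1⟩
    have hdist : |a - t| < ε ∧ |b - t| < ε := by
      have h1 : t - ε / 2 ≤ a := le_max_right _ _
      have h2 : b ≤ t + ε / 2 := min_le_right _ _
      constructor <;> rw [abs_lt] <;> constructor <;> linarith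
    -- The competitor is the segment between the two end points, whose velocity is again in `ker S`.
    set c := (b - a)⁻¹ • ((γ b).1 - (γ a).1) with hcdef
    have hba : b - a ≠ 0 := (sub_pos.2 hab).ne'
    have hcb : (γ b).1 - (γ a).1 = (b - a) • c := by rw [hcdef, smul_inv_smul₀ hba]
    have hc : c ∈ LinearMap.ker S := by
      refine Submodule.smul_mem _ _ ?_
      rw [hγ a haI, hγ b hbI, add_sub_add_left_eq_sub]
      exact Submodule.sub_mem _ (integral_control_mem_ker hker hbI)
        (integral_control_mem_ker hker haI)
    have hE := hmin a b ha0 hab.le hb1 hdist.1 hdist.2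
      (line ((γ a).1 - a • c) c (γ 0).2) (hS.isHorizontalOn_line _ hc _ a b)
      (Prod.ext (by simp [line]) (by rw [hγ a haI]; rfl))
      (Prod.ext
        (by rw [← sub_add_cancel (γ b).1 (γ a).1, hcb, sub_smul]; simp only [line]; abel)
        (by rw [hγ b hbI]; rfl))
    rw [energy_line] at hE
    have haff := (hgeo.1.mono (Icc_subset_Icc ha0 hb1)).fst_eq_of_energy_le hab.le hcb hE
    refine ⟨c, (γ a).1 - a • c, ?_⟩
    have hball : Ioo (t - ε / 2) (t + ε / 2) ∈ 𝓝 t :=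
      Ioo_mem_nhds (by linarith) (by linarith)
    filter_upwards [mem_nhdsWithin_of_mem_nhds hball, self_mem_nhdsWithin] with s hs hsI
    rw [haff s ⟨max_le hsI.1 hs.1.le, le_min hsI.2 hs.2.le⟩, sub_smul]
    abel
  obtain ⟨c, hc⟩ := eq_add_smul_of_locally_affine hloc
  have h1 : (1 : ℝ) ∈ Icc (0 : ℝ) 1 := right_mem_Icc.2 zero_le_one
  refine ⟨c, ?_, fun t ht => Prod.ext (hc t ht) (by rw [hγ t ht]; rfl)⟩
  have h2 := hc 1 h1
  rw [hγ 1 h1, one_smul] at h2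
  rw [← add_left_cancel h2]
  exact integral_control_mem_ker hker h1

/-- Abnormal geodesics in a group of generalized H-type are the lines with velocity in `ker S`. -/
theorem IsGenHType.isAbnormal_and_isGeodesic_iff (hS : G.IsGenHType S) (γ : ℝ → V × W) :
    (G.IsAbnormal γ ∧ G.IsGeodesic γ) ↔
      ∃ c ∈ LinearMap.ker S, EqOn γ (line (γ 0).1 c (γ 0).2) (Icc 0 1) :=
  ⟨fun h => hS.exists_eqOn_line h.1 h.2, fun ⟨_, hc, hγ⟩ =>
    ⟨hS.isAbnormal_of_eqOn_line hc hγ, hS.isGeodesic_of_eqOn_line hc hγ⟩⟩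

end StepTwoCarnot

/-! ### Normal extremals -/

namespace StepTwoCarnot

variable {V W : Type*} [NormedAddCommGroup V] [InnerProductSpace ℝ V] [FiniteDimensional ℝ V]
  [NormedAddCommGroup W] [InnerProductSpace ℝ W] [FiniteDimensional ℝ W]
  {G : StepTwoCarnot V W} {S : V →ₗ[ℝ] V}

/-- The differential of the vector field `G.field w`, which is affine in the base point. -/
noncomputable def fieldDeriv (G : StepTwoCarnot V W) (w : V) : V × W →L[ℝ] V × W :=
  (0 : V × W →L[ℝ] V).prod ((2⁻¹ : ℝ) • (G.bracketL.flip w ∘L ContinuousLinearMap.fst ℝ V W))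

theorem fieldDeriv_apply (G : StepTwoCarnot V W) (w : V) (q : V × W) :
    G.fieldDeriv w q = (0, (2⁻¹ : ℝ) • G.bracket q.1 w) := rfl

theorem hasFDerivAt_field (G : StepTwoCarnot V W) (w : V) (p : V × W) :
    HasFDerivAt (G.field w) (G.fieldDeriv w) p :=
  (hasFDerivAt_const w p).prodMk
    ((2⁻¹ : ℝ) • (G.bracketL.flip w ∘L ContinuousLinearMap.fst ℝ V W)).hasFDerivAt

/-- `G.field w p` as a linear function of `w`. -/
noncomputable def fieldL (G : StepTwoCarnot V W) (p : V × W) : V →ₗ[ℝ] V × W :=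
  LinearMap.id.prod ((2⁻¹ : ℝ) • G.bracket p.1)

theorem fieldL_apply (G : StepTwoCarnot V W) (p : V × W) (w : V) :
    G.fieldL p w = G.field w p := rfl

/-- The horizontal momentum of the covector `ξ` at `p`: the vector of `V` with coordinates
`⟨ξ, Xᵢ(p)⟩`. -/
noncomputable def momentum (G : StepTwoCarnot V W) (p : V × W) (ξ : V × W →L[ℝ] ℝ) : V :=
  ∑ i, ξ (G.field (stdOrthonormalBasis ℝ V i) p) • stdOrthonormalBasis ℝ V i

theorem inner_momentum (G : StepTwoCarnot V W) (p : V × W) (ξ : V × W →L[ℝ] ℝ) (w : V) :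
    ⟪G.momentum p ξ, w⟫ = ξ (G.field w p) := by
  conv_rhs => rw [← fieldL_apply, ← (stdOrthonormalBasis ℝ V).sum_repr' w]
  simp only [momentum, map_sum, map_smul, sum_inner, real_inner_smul_left, fieldL_apply,
    smul_eq_mul]
  exact Finset.sum_congr rfl fun i _ => mul_comm _ _

theorem momentum_covector (G : StepTwoCarnot V W) (p : V × W) (a : V) (v : W) :
    G.momentum p (covector a v) = a - (2⁻¹ : ℝ) • G.J v p.1 :=
  ext_inner_right ℝ fun w => by
    rw [inner_momentum, covector_apply, inner_sub_left, real_inner_smul_left, inner_J_left,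
      inner_J, field, inner_smul_right]
    ring

theorem hasFDerivAt_hamiltonian_snd (G : StepTwoCarnot V W) (p : V × W) (ξ : V × W →L[ℝ] ℝ) :
    HasFDerivAt (G.hamiltonian p)
      (ContinuousLinearMap.apply ℝ ℝ (G.field (G.momentum p ξ) p)) ξ := by
  have h : HasFDerivAt (G.hamiltonian p) _ ξ :=
    (HasFDerivAt.fun_sum (u := Finset.univ) fun i _ => (ContinuousLinearMap.apply ℝ ℝ
      (G.field (stdOrthonormalBasis ℝ V i) p)).hasFDerivAt.pow 2).const_mul (2⁻¹ : ℝ)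
  refine h.congr_fderiv (ContinuousLinearMap.ext fun η => ?_)
  rw [ContinuousLinearMap.apply_apply, ← fieldL_apply, momentum]
  simp only [map_sum, map_smul, fieldL_apply, _root_.smul_apply,
    _root_.sum_apply, ContinuousLinearMap.apply_apply, smul_eq_mul, Finset.mul_sum]
  refine Finset.sum_congr rfl fun i _ => ?_
  norm_num
  ring

theorem hasFDerivAt_hamiltonian_fst (G : StepTwoCarnot V W) (p : V × W) (ξ : V × W →L[ℝ] ℝ) :
    HasFDerivAt (fun q => G.hamiltonian q ξ) (ξ ∘L G.fieldDeriv (G.momentum p ξ)) p := by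
  have h : HasFDerivAt (fun q => G.hamiltonian q ξ) _ p :=
    (HasFDerivAt.fun_sum (u := Finset.univ) fun i _ => (ξ.hasFDerivAt.comp p
      (G.hasFDerivAt_field (stdOrthonormalBasis ℝ V i) p)).pow 2).const_mul (2⁻¹ : ℝ)
  refine h.congr_fderiv (ContinuousLinearMap.ext fun δ => ?_)
  have h2 : G.fieldDeriv (G.momentum p ξ) δ = ∑ i, ξ (G.field (stdOrthonormalBasis ℝ V i) p) •
      G.fieldDeriv (stdOrthonormalBasis ℝ V i) δ := by
    simp [fieldDeriv_apply, momentum, Prod.ext_iff, Prod.fst_sum, Prod.snd_sum, Finset.smul_sum,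
      smul_comm (2⁻¹ : ℝ)]
  rw [ContinuousLinearMap.comp_apply, h2]
  simp only [map_sum, map_smul, _root_.smul_apply, _root_.sum_apply,
    ContinuousLinearMap.comp_apply, smul_eq_mul, Finset.mul_sum, Function.comp_apply]
  refine Finset.sum_congr rfl fun i _ => ?_
  norm_num
  ring

/-- Hamilton's equations in terms of the momentum. -/
theorem isNormalExtremal_iff (G : StepTwoCarnot V W) (p : ℝ → V × W)
    (ξ : ℝ → V × W →L[ℝ] ℝ) :
    G.IsNormalExtremal p ξ ↔ ∀ t ∈ Icc (0 : ℝ) 1,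
      HasDerivWithinAt p (G.field (G.momentum (p t) (ξ t)) (p t)) (Icc 0 1) t ∧
      HasDerivWithinAt ξ (-(ξ t ∘L G.fieldDeriv (G.momentum (p t) (ξ t)))) (Icc 0 1) t := by
  refine forall₂_congr fun t _ => ?_
  rw [(G.hasFDerivAt_hamiltonian_fst (p t) (ξ t)).fderiv,
    (G.hasFDerivAt_hamiltonian_snd (p t) (ξ t)).fderiv]
  refine and_congr_left fun _ => ⟨?_, fun h => ⟨_, h, fun _ => rfl⟩⟩
  rintro ⟨w, hw, h⟩
  rwa [← (SeparatingDual.eq_iff_forall_dual_eq (R := ℝ)).2 h]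

/-- For `u ∈ ker S`, the line with velocity `u` lifts to the normal extremal with constant
covector `(u, v)`. -/
theorem IsGenHType.isNormalExtremal_line (hS : G.IsGenHType S) {u : V}
    (hu : u ∈ LinearMap.ker S) (v : W) :
    G.IsNormalExtremal (line 0 u 0) fun _ => covector u v := by
  refine (G.isNormalExtremal_iff _ _).2 fun t _ => ?_
  have hm : G.momentum (line 0 u 0 t) (covector u v) = u := by
    simp [momentum_covector, line, hS.J_eq_zero hu]
  rw [hm]
  refine ⟨(hS.hasDerivAt_line 0 hu 0 t).hasDerivWithinAt, ?_⟩
  have h0 : covector u v ∘L G.fieldDeriv u = 0 := ContinuousLinearMap.ext fun δ => by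
    simp [fieldDeriv_apply, covector_apply, hS.bracket_right_eq_zero hu]
  rw [h0, neg_zero]
  exact hasDerivWithinAt_const t _ (covector u v)

/-- Uniqueness for Hamilton's equations with initial covector `(u, v)`, `u ∈ ker S`. The second
component of the covector is constant, the momentum `h` solves `h' = -J_v h`, and
`‖h - u‖` is constant because `J_v` is skew-symmetric and kills `u`. -/
theorem IsGenHType.eq_line_of_isNormalExtremal (hS : G.IsGenHType S) {u : V}
    (hu : u ∈ LinearMap.ker S) (v : W) {p : ℝ → V × W} {ξ : ℝ → V × W →L[ℝ] ℝ}
    (h : G.IsNormalExtremal p ξ) (hp : p 0 = 0) (hξ : ξ 0 = covector u v) :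
    EqOn p (line 0 u 0) (Icc 0 1) := by
  have : CompleteSpace V := FiniteDimensional.complete ℝ V
  rw [isNormalExtremal_iff] at h
  have hev : ∀ q : V × W, ∀ t ∈ Icc (0 : ℝ) 1, HasDerivWithinAt (fun t => ξ t q)
      (-ξ t (G.fieldDeriv (G.momentum (p t) (ξ t)) q)) (Icc 0 1) t := fun q t ht =>
    (ContinuousLinearMap.apply ℝ ℝ q).hasFDerivAt.comp_hasDerivWithinAt t (h t ht).2
  have hsnd : ∀ w : W, ∀ t ∈ Icc (0 : ℝ) 1, ξ t (0, w) = ⟪v, w⟫ := fun w t ht => by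
    have h1 := eq_of_hasDerivWithinAt_zero (f := fun t => ξ t (0, w)) (fun s hs => by
      have h2 := hev (0, w) s hs
      rwa [fieldDeriv_apply, map_zero, LinearMap.zero_apply, smul_zero, Prod.mk_zero_zero,
        map_zero, neg_zero] at h2) t ht
    rw [h1, hξ]
    simp [covector_apply]
  set m : ℝ → V := fun t => G.momentum (p t) (ξ t) with hm
  have hminner : ∀ w : V, ∀ t ∈ Icc (0 : ℝ) 1,
      ⟪m t, w⟫ = ξ t (w, 0) - 2⁻¹ * ⟪G.J v (p t).1, w⟫ := fun w t ht => by
    have h1 : G.field w (p t) = (w, 0) + (0, (2⁻¹ : ℝ) • G.bracket (p t).1 w) := by simp [field]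
    rw [hm, inner_momentum, h1, map_add, hsnd _ t ht, inner_smul_right, inner_J_left, inner_J]
    ring
  have hmder : ∀ w : V, ∀ t ∈ Icc (0 : ℝ) 1,
      HasDerivWithinAt (fun t => ⟪m t, w⟫) (-⟪G.J v (m t), w⟫) (Icc 0 1) t := fun w t ht => by
    have h1 : HasDerivWithinAt (fun t => (p t).1) (m t) (Icc 0 1) t :=
      (ContinuousLinearMap.fst ℝ V W).hasFDerivAt.comp_hasDerivWithinAt t (h t ht).1
    have h2 : HasDerivWithinAt (fun t => ⟪G.J v (p t).1, w⟫) ⟪G.J v (m t), w⟫ (Icc 0 1) t := by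
      have := ((innerSL ℝ w) ∘L
        (LinearMap.toContinuousLinearMap (G.J v))).hasFDerivAt.comp_hasDerivWithinAt t h1
      simp only [real_inner_comm w]
      exact this
    have h3 := (hev (w, 0) t ht).fun_sub (h2.const_mul (2⁻¹ : ℝ))
    refine HasDerivWithinAt.congr_of_mem ?_ (hminner w) ht
    convert h3 using 1
    rw [fieldDeriv_apply, hsnd _ t ht, inner_smul_right, inner_J_left, inner_J,
      G.bracket_swap]
    change _ = -(2⁻¹ * ⟪v, G.bracket w (m t)⟫) - _
    rw [G.bracket_swap]
    simp only [inner_neg_right]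
    ring
  have hmu : ∀ t ∈ Icc (0 : ℝ) 1, m t = u := by
    have hmder' : ∀ t ∈ Icc (0 : ℝ) 1,
        HasDerivWithinAt (fun t => m t - u) (-G.J v (m t - u)) (Icc 0 1) t := fun t ht => by
      have h1 := HasDerivWithinAt.fun_sum (u := Finset.univ) fun i _ =>
        (hmder (stdOrthonormalBasis ℝ V i) t ht).smul_const (stdOrthonormalBasis ℝ V i)
      have h2 : ∀ x : V, ∑ i, ⟪x, stdOrthonormalBasis ℝ V i⟫ • stdOrthonormalBasis ℝ V i = x :=
        fun x => by
          simp only [real_inner_comm _ x]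
          exact (stdOrthonormalBasis ℝ V).sum_repr' x
      simp only [neg_smul, Finset.sum_neg_distrib, h2] at h1
      rw [map_sub, hS.J_eq_zero hu, sub_zero]
      exact h1.sub_const u
    have h0 : m 0 = u := by
      simp only [hm, hp, hξ, momentum_covector, Prod.fst_zero, map_zero, smul_zero, sub_zero]
    intro t ht
    -- `‖m - u‖²` has derivative `-2 ⟪m - u, J_v (m - u)⟫ = 0`.
    have h1 := eq_of_hasDerivWithinAt_zero (f := fun t => ‖m t - u‖ ^ 2) (fun s hs => by
      have h2 := (hmder' s hs).norm_sq
      rwa [inner_neg_right, real_inner_comm, inner_J_self, neg_zero,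
        MulZeroClass.mul_zero] at h2) t ht
    simpa [h0, sub_eq_zero] using h1
  have hline : ∀ t ∈ Icc (0 : ℝ) 1,
      HasDerivWithinAt (fun t => p t - line 0 u 0 t) 0 (Icc 0 1) t := fun t ht => by
    have h1 := (h t ht).1
    have h2 : G.momentum (p t) (ξ t) = u := hmu t ht
    rw [h2, field, hS.bracket_right_eq_zero hu, smul_zero] at h1
    simpa using h1.fun_sub (StepTwoCarnot.hasDerivAt_line 0 u (0 : W) t).hasDerivWithinAt
  intro t ht
  have h1 := eq_of_hasDerivWithinAt_zero hline t ht
  rw [hp] at h1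
  refine sub_eq_zero.1 (h1.trans ?_)
  simp [line]

end StepTwoCarnot

/-! ### The classification -/

theorem lemma5p2 {V W : Type*} [NormedAddCommGroup V] [InnerProductSpace ℝ V]
    [FiniteDimensional ℝ V] [NormedAddCommGroup W] [InnerProductSpace ℝ W]
    [FiniteDimensional ℝ W] (G : StepTwoCarnot V W) (S : V →ₗ[ℝ] V) (hS : G.IsGenHType S) :
    -- abnormal curves
    (∀ γ : ℝ → V × W, G.IsAbnormal γ ↔
      (∃ K : ℝ≥0, LipschitzOnWith K γ (Icc 0 1)) ∧
        ∃ u : CarnotControl V, G.HasControlOn γ u 0 1 ∧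
          ∀ᵐ t ∂volume.restrict (Icc (0 : ℝ) 1), u t ∈ LinearMap.ker S) ∧
    -- abnormal geodesics from an arbitrary point are left translates of straight lines
    (∀ γ : ℝ → V × W, (G.IsAbnormal γ ∧ G.IsGeodesic γ) ↔
      ∃ u ∈ LinearMap.ker S, ∀ t ∈ Icc (0 : ℝ) 1, γ t = G.mul (γ 0) (t • u, 0)) ∧
    -- abnormal geodesics from the identity
    (∀ γ : ℝ → V × W, γ 0 = 0 →
      ((G.IsAbnormal γ ∧ G.IsGeodesic γ) ↔
        ∃ u ∈ LinearMap.ker S, ∀ t ∈ Icc (0 : ℝ) 1, γ t = (t • u, 0)) ∧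
      ((G.IsAbnormal γ ∧ G.IsGeodesic γ) ↔
        ∃ u ∈ LinearMap.ker S, ∃ v : W, G.IsNormalGeodesic γ (StepTwoCarnot.covector u v))) ∧
    -- the straight lines are normal geodesics, for every covector component `v`
    (∀ u ∈ LinearMap.ker S, ∀ v : W,
      G.IsNormalGeodesic (fun t => (t • u, 0)) (StepTwoCarnot.covector u v) ∧
      ∀ t ∈ Icc (0 : ℝ) 1, G.expMap (StepTwoCarnot.covector (t • u) (t • v)) = (t • u, 0)) := by
  have hline : ∀ u : V, EqOn (fun t : ℝ => ((t • u, 0) : V × W)) (StepTwoCarnot.line 0 u 0)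
      (Icc 0 1) := fun u t _ => by simp [StepTwoCarnot.line]
  have hnormal : ∀ u ∈ LinearMap.ker S, ∀ v : W, ∀ γ : ℝ → V × W,
      (∀ t ∈ Icc (0 : ℝ) 1, γ t = (t • u, 0)) →
        G.IsNormalGeodesic γ (StepTwoCarnot.covector u v) := fun u hu v γ hγ =>
    ⟨hS.isGeodesic_of_eqOn_line hu (EqOn.trans hγ (hline u)), _, _,
      hS.isNormalExtremal_line hu v, by simp [StepTwoCarnot.line], rfl,
      EqOn.trans hγ (hline u)⟩
  have habn : ∀ γ : ℝ → V × W, γ 0 = 0 → ((G.IsAbnormal γ ∧ G.IsGeodesic γ) ↔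
      ∃ u ∈ LinearMap.ker S, ∀ t ∈ Icc (0 : ℝ) 1, γ t = (t • u, 0)) := fun γ hγ => by
    rw [hS.isAbnormal_and_isGeodesic_iff, hγ]
    exact exists_congr fun u => and_congr_right fun _ =>
      ⟨fun h => h.trans (hline u).symm, fun h => EqOn.trans h (hline u)⟩
  refine ⟨hS.isAbnormal_iff, fun γ => ?_, fun γ hγ => ⟨habn γ hγ, ?_⟩, fun u hu v =>
    ⟨hnormal u hu v _ fun _ _ => rfl, fun t _ => ?_⟩⟩
  · rw [hS.isAbnormal_and_isGeodesic_iff]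
    refine exists_congr fun u => and_congr_right fun hu => forall₂_congr fun t _ => ?_
    rw [hS.mul_eq_line _ hu]
  · rw [habn γ hγ]
    constructor
    · rintro ⟨u, hu, h⟩
      exact ⟨u, hu, 0, hnormal u hu 0 γ h⟩
    · rintro ⟨u, hu, v, -, p, ξ, hpξ, hp, hξ, hγp⟩
      exact ⟨u, hu, EqOn.trans (EqOn.trans hγp (hS.eq_line_of_isNormalExtremal hu v hpξ hp hξ))
        (hline u).symm⟩
  · have hu' : t • u ∈ LinearMap.ker S := Submodule.smul_mem _ t hu
    have hex : ∃ (p : ℝ → V × W) (ξ : ℝ → V × W →L[ℝ] ℝ), G.IsNormalExtremal p ξ ∧ p 0 = 0 ∧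
        ξ 0 = StepTwoCarnot.covector (t • u) (t • v) :=
      ⟨_, _, hS.isNormalExtremal_line hu' _, by simp [StepTwoCarnot.line], rfl⟩
    obtain ⟨ξ, hpξ, hp, hξ⟩ := hex.choose_spec
    rw [StepTwoCarnot.expMap, dif_pos hex,
      hS.eq_line_of_isNormalExtremal hu' _ hpξ hp hξ (right_mem_Icc.2 zero_le_one)]
    simp [StepTwoCarnot.line]
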